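/- Let $R$ be a discrete valuation ring with field of fractions $K$ and residue field $k$ (equivalently, $K$ is a field with a discrete valuation, not necessarily complete, and $R$ is its valuation ring), and let $K(t)$ be the rational function field in one variable over $K$. A finite group $G$ is called admissible over a field $F$ if there is a finite-dimensional division algebra $D$ with centre $F$ and a maximal subfield $L$ of $D$ which is Galois over $F$ with $\mathrm{Gal}(L/F)\cong G$. For $a,b\in F^*$ and a primitive $n$-th root of unity $\zeta\in F$, let $(a,b)_n$ denote the $F$-algebra generated by $x,y$ with the relations $x^n=a$, $y^n=b$, $xy=\zeta yx$. (1) Let $n,m\geq 1$ be integers not divisible by $\mathrm{char}(k)$ (no condition if $\mathrm{char}(k)=0$) such that $K$ contains a primitive $n$-th root of unity and a primitive $m$-th root of unity. Let $\lambda_0\in k$ be such that $[k(\sqrt[n]{\lambda_0}):k]=n$. Then for every uniformizer $\pi$ of $R$, every $\lambda\in R$ with image $\lambda_0$ in $k$, and every choice of the primitive roots of unity, the algebra $(t,\pi-\lambda t)_n\otimes_{K(t)}(t+1,\pi)_m$ is a finite-dimensional central division algebra over $K(t)$. (2) Let $l_1,l_2,l_3,l_4\geq 1$ be integers such that $n=l_1l_2l_3l_4$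 is not divisible by $\mathrm{char}(k)$ (no condition if $\mathrm{char}(k)=0$) and $K$ contains a primitive $n$-th root of unity. Suppose that $\lambda_0\in k$ satisfies $[k(\sqrt[l_1l_2]{\lambda_0}):k]=l_1l_2$. Then $G=\mathbb{Z}/l_1\mathbb{Z}\times\mathbb{Z}/l_2\mathbb{Z}\times\mathbb{Z}/l_3\mathbb{Z}\times\mathbb{Z}/l_4\mathbb{Z}$ is admissible over $K(t)$. More precisely, for every uniformizer $\pi$ of $R$, every $\lambda\in R$ with image $\lambda_0$ in $k$, and every choice of the primitive roots of unity of orders $l_1l_2$ and $l_3l_4$, the algebra $(t,\pi-\lambda t)_{l_1l_2}\otimes_{K(t)}(t+1,\pi)_{l_3l_4}$ is a finite-dimensional central division algebra over $K(t)$ which contains a maximal subfield that is Galois over $K(t)$ with Galois group isomorphic to $G$. -/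

import Mathlib

open scoped TensorProduct

universe u v w

/-- The defining relations of the symbol algebra `(a, b)_n` on the free algebra on `x` (index `0`)
and `y` (index `1`): `x ^ n = a`, `y ^ n = b`, `x * y = ζ * y * x`. -/
inductive SymbolAlgebra.Rel (F : Type u) [Field F] (n : ℕ) (ζ a b : F) :
    FreeAlgebra F (Fin 2) → FreeAlgebra F (Fin 2) → Prop
  | x_pow : SymbolAlgebra.Rel F n ζ a b
      (FreeAlgebra.ι F 0 ^ n) (algebraMap F (FreeAlgebra F (Fin 2)) a)
  | y_pow : SymbolAlgebra.Rel F n ζ a b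
      (FreeAlgebra.ι F 1 ^ n) (algebraMap F (FreeAlgebra F (Fin 2)) b)
  | x_mul_y : SymbolAlgebra.Rel F n ζ a b
      (FreeAlgebra.ι F 0 * FreeAlgebra.ι F 1)
      (algebraMap F (FreeAlgebra F (Fin 2)) ζ * (FreeAlgebra.ι F 1 * FreeAlgebra.ι F 0))

/-- The symbol algebra `(a, b)_n` over `F` with respect to the `n`-th root of unity `ζ`: the
associative `F`-algebra generated by `x`, `y` subject to `x ^ n = a`, `y ^ n = b`, `x y = ζ y x`. -/
def SymbolAlgebra (F : Type u) [Field F] (n : ℕ) (ζ a b : F) : Type u :=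
  RingQuot (SymbolAlgebra.Rel F n ζ a b)

noncomputable instance SymbolAlgebra.instRing (F : Type u) [Field F] (n : ℕ) (ζ a b : F) :
    Ring (SymbolAlgebra F n ζ a b) :=
  inferInstanceAs (Ring (RingQuot (SymbolAlgebra.Rel F n ζ a b)))

noncomputable instance SymbolAlgebra.instAlgebra (F : Type u) [Field F] (n : ℕ) (ζ a b : F) :
    Algebra F (SymbolAlgebra F n ζ a b) :=
  inferInstanceAs (Algebra F (RingQuot (SymbolAlgebra.Rel F n ζ a b)))

/-- `D` is a central division algebra over `F`: a finite-dimensional `F`-algebra with centre `F`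
which is a division ring. -/
structure IsCentralDivisionAlgebra (F : Type u) (D : Type v) [Field F] [Ring D] [Algebra F D] :
    Prop where
  finite : FiniteDimensional F D
  central : Algebra.IsCentral F D
  nontrivial : Nontrivial D
  isUnit_of_ne_zero : ∀ x : D, x ≠ 0 → IsUnit x

/-- `S` is a maximal subfield of the `F`-algebra `D`, i.e. maximal for inclusion among the
`F`-subalgebras that are (commutative) fields. (If `D` is a division ring with centre `F`, every
maximal subfield contains `F`.) -/
def IsMaximalSubfield (F : Type u) (D : Type v) [Field F] [Ring D] [Algebra F D]
    (S : Subalgebra F D) : Prop :=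
  Maximal (fun T : Subalgebra F D => IsField T) S

/-- `D` contains, as a maximal subfield, a finite Galois extension `L` of `F` whose Galois group
is isomorphic to `G`. -/
def HasMaximalGaloisSubfield (F : Type u) (D : Type v) (G : Type w) [Field F] [Ring D]
    [Algebra F D] [Group G] : Prop :=
  ∃ (L : Type v) (_ : Field L) (_ : Algebra F L) (f : L →ₐ[F] D),
    FiniteDimensional F L ∧ IsGalois F L ∧ Nonempty (Gal(L/F) ≃* G) ∧
      IsMaximalSubfield F D f.range

/-- The group `G` (necessarily finite) is admissible over `F`: there is a division ring `D`
central over `F` having a maximal subfield that is Galois over `F` with group `G`. Such a `D` is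
automatically finite-dimensional over `F`, so it may be taken in the universe of `F`. -/
def IsAdmissible (F : Type u) (G : Type w) [Field F] [Group G] : Prop :=
  ∃ (D : Type u) (_ : Ring D) (_ : Algebra F D),
    IsCentralDivisionAlgebra F D ∧ HasMaximalGaloisSubfield F D G

/-- `[k(ⁿ√c) : k] = n`, for an `n`-th root of `c` in an algebraic closure of `k`. (If `k`
contains a primitive `n`-th root of unity, the field does not depend on the chosen root.) -/
def RadicalDegreeEq (k : Type u) [Field k] (n : ℕ) (c : k) : Prop :=
  ∃ α : AlgebraicClosure k, α ^ n = algebraMap k (AlgebraicClosure k) c ∧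
    Module.finrank k (IntermediateField.adjoin k {α}) = n

/-- The algebra `(t, π - μ t)_n ⊗ (t + 1, π)_m` over the rational function field `K(t)`, with
respect to the roots of unity `ζ₁` (for `n`) and `ζ₂` (for `m`) in `K`. -/
abbrev SymbolTensor (K : Type u) [Field K] (n m : ℕ) (ζ₁ ζ₂ π μ : K) : Type u :=
  SymbolAlgebra (RatFunc K) n (RatFunc.C ζ₁) RatFunc.X (RatFunc.C π - RatFunc.C μ * RatFunc.X)
    ⊗[RatFunc K]
  SymbolAlgebra (RatFunc K) m (RatFunc.C ζ₂) (RatFunc.X + 1) (RatFunc.C π)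

/-! A finite-dimensional algebra over a field is a division algebra as soon as it has no zero
divisors, and this can be tested on an order. Take the order `B = (t, π - μt)_n ⊗ (t + 1, π)_m` over
`R[t]`; after inverting the nonzero elements of `R[t]` it becomes the algebra over `K(t)`. The
engine is `noZeroDivisors_of_normal_element`: if `p` is normal, some power of `p` is a nonzero
nonunit scalar, and the ring modulo `p` embeds in a domain, then filtering by powers of `p` shows
that the ring is a domain. It is applied twice. In `B`, let `p = 1 ⊗ y`, so `p ^ m = π`. Modulo `p`,
the scalars become `k[t]`, the second factor becomes `k[t][w]` with `w ^ m = t + 1`, and the first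
becomes `(t, -μt)_n`. Put `w = 1 + X` in `k⟦X⟧`, so that `t` becomes `τ = (1 + X) ^ m - 1`. Since
`m` is invertible in `k`, `τ` is a uniformizer. As `(-(xz)) ^ n = -x ^ n z ^ n` for a symbol pair
`x, z`, the algebra `(τ, -μτ)_n` sits inside `(τ, μ)_n`. In `(τ, μ)_n` over `k⟦X⟧`, let `p = x`, so
`p ^ n = τ`. Modulo `x` there remains `k[Y]/(Y ^ n - μ)`, a field by the degree hypothesis.
Conjugation by the generators acts diagonally on the monomial basis. This determines the centre, and
shows that `x₁ ^ l₁`, `y₁ ^ l₂`, `x₂ ^ l₃`, `y₂ ^ l₄` generate a commutative subalgebra equal to its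
own centralizer, hence a maximal subfield. It is a Kummer extension of full degree `l₁l₂l₃l₄`, which
gives its Galois group. -/

/-! ### Domains from normal elements -/

/-- Let `B` be free over a domain `S`, and let `p ∈ B` be a normal element a power of which is a
nonzero nonunit scalar `c`. If the quotient of `B` by `p` embeds into a domain,
then `B` has no zero divisors. -/
theorem noZeroDivisors_of_normal_element {S B Q I : Type*} [CommRing S] [IsDomain S]
    [WfDvdMonoid S] [Ring B]
    [Algebra S B] [Ring Q] [NoZeroDivisors Q] [Fintype I] (e : Module.Basis I S B) (p : B) (N : ℕ)
    (c : S) (hp : p ^ N = algebraMap S B c) (hc0 : c ≠ 0)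
    (hcu : ¬IsUnit c)
    (hcomm : ∀ I, ∃ u : Sˣ, e I * p = u • (p * e I)) (φ : B →+* Q) (hφp : φ p = 0)
    (hker : ∀ b, φ b = 0 → ∀ I, (∃ b', e I = p * b') ∨ c ∣ e.repr b I)
    (hN : N ≠ 0) : NoZeroDivisors B := by
  classical
  obtain ⟨M, rfl⟩ := Nat.exists_eq_succ_of_ne_zero hN
  have hr : ∀ b : B, ∃ b', b * p = p * b' := by
    intro b
    choose u hu using hcomm
    refine ⟨∑ I, e.repr b I • (u I • e I), ?_⟩
    conv_lhs => rw [← e.sum_repr b]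
    rw [Finset.sum_mul, Finset.mul_sum]
    refine Finset.sum_congr rfl fun I _ => ?_
    rw [smul_mul_assoc, hu, mul_smul_comm, mul_smul_comm]
  have hl : ∀ b : B, ∃ b', p * b = b' * p := by
    intro b
    choose u hu using hcomm
    refine ⟨∑ I, e.repr b I • ((u I)⁻¹ • e I), ?_⟩
    conv_lhs => rw [← e.sum_repr b]
    rw [Finset.sum_mul, Finset.mul_sum]
    refine Finset.sum_congr rfl fun I _ => ?_
    rw [smul_mul_assoc, smul_mul_assoc, hu, mul_smul_comm, inv_smul_smul]
  -- Freeness makes `c` a nonzerodivisor on `B`; since `c` is a power of `p`, so is `p` on both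
  -- sides.
  have hreg : ∀ b : B, c • b = 0 → b = 0 := by
    intro b hb
    refine e.ext_elem fun I => ?_
    have := congrArg (fun x => e.repr x I) hb
    simpa [hc0] using this
  have hpl : ∀ b : B, p * b = 0 → b = 0 := by
    intro b hb
    refine hreg b ?_
    rw [Algebra.smul_def, ← hp, pow_succ, mul_assoc, hb, mul_zero]
  have hpr : ∀ b : B, b * p = 0 → b = 0 := by
    intro b hb
    refine hreg b ?_
    rw [Algebra.smul_def, Algebra.commutes, ← hp, pow_succ', ← mul_assoc, hb, zero_mul]
  -- The kernel of `φ` is `pB`: each term of `b` is divisible by `p`, through its basis element or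
  -- through its coefficient, as `c = p ^ N`.
  have hdvd : ∀ b : B, φ b = 0 → ∃ b', b = p * b' := by
    intro b hb
    have : ∀ I, ∃ b', e.repr b I • e I = p * b' := by
      intro I
      rcases hker b hb I with ⟨b', hb'⟩ | ⟨d, hd⟩
      · exact ⟨e.repr b I • b', by rw [hb', mul_smul_comm]⟩
      · refine ⟨p ^ M * (d • e I), ?_⟩
        rw [← mul_assoc, ← pow_succ', hp, hd, mul_smul, Algebra.smul_def c]
    choose f hf using this
    refine ⟨∑ I, f I, ?_⟩
    conv_lhs => rw [← e.sum_repr b]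
    rw [Finset.mul_sum]
    exact Finset.sum_congr rfl fun I _ => hf I
  -- The `p`-adic filtration is separated: divisibility of `b` by all powers of `p` would make a
  -- nonzero coordinate divisible by all powers of the nonunit `c`.
  have hex : ∀ b : B, b ≠ 0 → ∃ i b', b = p ^ i * b' ∧ φ b' ≠ 0 := by
    intro b hb
    by_contra! hcon
    have hall : ∀ i : ℕ, ∃ b', b = p ^ i * b' := by
      intro i
      induction i with
      | zero => exact ⟨b, by simp⟩
      | succ i ih =>
        obtain ⟨b', hb'⟩ := ih
        obtain ⟨b'', hb''⟩ := hdvd b' (hcon i b' hb')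
        exact ⟨b'', by rw [hb', hb'', pow_succ, mul_assoc]⟩
    refine hb (e.ext_elem fun I => ?_)
    rw [map_zero, Finsupp.zero_apply]
    by_contra hne
    obtain ⟨i, hi⟩ := FiniteMultiplicity.of_not_isUnit hcu hne
    refine hi ?_
    generalize i + 1 = i
    obtain ⟨b', hb'⟩ := hall ((M + 1) * i)
    refine ⟨e.repr b' I, ?_⟩
    rw [hb', pow_mul, hp, ← map_pow, ← Algebra.smul_def, map_smul, Finsupp.smul_apply, smul_eq_mul]
  -- Conjugation by `p` preserves `pB`, hence also its complement.
  have hshift : ∀ (j : ℕ) (a : B), φ a ≠ 0 → ∃ a', a * p ^ j = p ^ j * a' ∧ φ a' ≠ 0 := by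
    intro j
    induction j with
    | zero => exact fun a ha => ⟨a, by simp, ha⟩
    | succ j ih =>
      intro a ha
      obtain ⟨a', ha', hφ⟩ := ih a ha
      obtain ⟨a'', ha''⟩ := hr a'
      refine ⟨a'', by rw [pow_succ, ← mul_assoc, ha', mul_assoc, ha'', mul_assoc], fun h0 => hφ ?_⟩
      obtain ⟨d, rfl⟩ := hdvd a'' h0
      obtain ⟨d', hd'⟩ := hl d
      have h1 : (a' - p * d') * p = 0 := by
        rw [sub_mul, ha'', mul_assoc, ← hd', sub_self]
      rw [sub_eq_zero.mp (hpr _ h1), map_mul, hφp, zero_mul]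
  have hplk : ∀ (i : ℕ) (b : B), p ^ i * b = 0 → b = 0 := by
    intro i
    induction i with
    | zero => intro b hb; simpa using hb
    | succ i ih =>
      intro b hb
      rw [pow_succ, mul_assoc] at hb
      exact hpl b (ih _ hb)
  refine ⟨fun {a b} hab => ?_⟩
  by_contra! h
  obtain ⟨i, a', rfl, ha'⟩ := hex a h.1
  obtain ⟨j, b', rfl, hb'⟩ := hex b h.2
  obtain ⟨a'', h1, h2⟩ := hshift j a' ha'
  have h3 : p ^ i * (p ^ j * (a'' * b')) = 0 := by
    rw [← hab, mul_assoc, ← mul_assoc a', h1, mul_assoc]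
  have h4 := hplk _ _ (hplk _ _ h3)
  have h5 : φ a'' * φ b' = 0 := by rw [← map_mul, h4, map_zero]
  exact (mul_ne_zero h2 hb') h5

/-! ### Pairs of elements satisfying the symbol relations -/

/-- The elements `x`, `y` of an `S`-algebra satisfy `x ^ n = a`, `y ^ n = b`, `x y = ζ y x`. -/
structure IsSymbolPair {S B : Type*} [CommRing S] [Ring B] [Algebra S B] (n : ℕ) (ζ a b : S)
    (x y : B) : Prop where
  x_pow : x ^ n = algebraMap S B a
  y_pow : y ^ n = algebraMap S B b
  x_mul_y : x * y = ζ • (y * x)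

/-- The monomials `y ^ i * x ^ j` with `i, j < n`. -/
def symbolMonomial {B : Type*} [Ring B] (n : ℕ) (x y : B) (I : Fin n × Fin n) : B :=
  y ^ (I.1 : ℕ) * x ^ (I.2 : ℕ)

namespace IsSymbolPair

variable {S B : Type*} [CommRing S] [Ring B] [Algebra S B] {n : ℕ} {ζ a b : S} {x y : B}

theorem map {B' : Type*} [Ring B'] [Algebra S B'] (h : IsSymbolPair n ζ a b x y)
    (f : B →ₐ[S] B') : IsSymbolPair n ζ a b (f x) (f y) where
  x_pow := by rw [← map_pow, h.x_pow, AlgHom.commutes]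
  y_pow := by rw [← map_pow, h.y_pow, AlgHom.commutes]
  x_mul_y := by rw [← map_mul, h.x_mul_y, map_smul, map_mul]

theorem x_mul_y_pow (h : IsSymbolPair n ζ a b x y) (j : ℕ) :
    x * y ^ j = ζ ^ j • (y ^ j * x) := by
  induction j with
  | zero => simp
  | succ j ih =>
    rw [pow_succ, ← mul_assoc, ih, smul_mul_assoc, mul_assoc, h.x_mul_y, mul_smul_comm, smul_smul,
      ← mul_assoc, pow_succ]

theorem x_pow_mul_y_pow (h : IsSymbolPair n ζ a b x y) (i j : ℕ) :
    x ^ i * y ^ j = ζ ^ (i * j) • (y ^ j * x ^ i) := by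
  induction i with
  | zero => simp
  | succ i ih =>
    rw [pow_succ, mul_assoc, h.x_mul_y_pow, mul_smul_comm, ← mul_assoc, ih, smul_mul_assoc,
      smul_smul, mul_assoc, ← pow_add]
    congr 2
    ring

theorem monomial_mem_span (h : IsSymbolPair n ζ a b x y) (hn : n ≠ 0) (i j : ℕ) :
    y ^ i * x ^ j ∈ Submodule.span S (Set.range (symbolMonomial n x y)) := by
  have key : y ^ i * x ^ j = (b ^ (i / n) * a ^ (j / n)) • (y ^ (i % n) * x ^ (j % n)) := by
    conv_lhs => rw [← Nat.div_add_mod i n, ← Nat.div_add_mod j n, pow_add, pow_add, pow_mul,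
      pow_mul, h.x_pow, h.y_pow, ← map_pow, ← map_pow]
    rw [mul_smul, Algebra.smul_def, Algebra.smul_def, mul_assoc, ← mul_assoc (y ^ (i % n)),
      ← Algebra.commutes (a ^ (j / n)), mul_assoc]
  rw [key]
  exact Submodule.smul_mem _ _ (Submodule.subset_span
    ⟨(⟨i % n, Nat.mod_lt _ (Nat.pos_of_ne_zero hn)⟩,
      ⟨j % n, Nat.mod_lt _ (Nat.pos_of_ne_zero hn)⟩), rfl⟩)

/-- If `x` and `y` generate the algebra, then the monomials span it. -/
theorem span_monomial (h : IsSymbolPair n ζ a b x y) (hn : n ≠ 0)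
    (hgen : Algebra.adjoin S {x, y} = ⊤) :
    Submodule.span S (Set.range (symbolMonomial n x y)) = ⊤ := by
  rw [eq_top_iff]
  intro z _
  have hz : z ∈ Algebra.adjoin S {x, y} := hgen ▸ Algebra.mem_top
  induction hz using Algebra.adjoin_induction with
  | mem z hz =>
    rcases hz with rfl | rfl
    · simpa using h.monomial_mem_span hn 0 1
    · simpa using h.monomial_mem_span hn 1 0
  | algebraMap r =>
    rw [Algebra.algebraMap_eq_smul_one]
    exact Submodule.smul_mem _ _ (by simpa using h.monomial_mem_span hn 0 0)
  | add z w _ _ hz hw => exact Submodule.add_mem _ (hz trivial) (hw trivial)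
  | mul z w _ _ hz hw =>
    refine Submodule.span_induction₂ (p := fun z w _ _ => z * w ∈ _) ?_ ?_ ?_ ?_ ?_ ?_ ?_
      (hz trivial) (hw trivial)
    · rintro _ _ ⟨I, rfl⟩ ⟨J, rfl⟩
      have : symbolMonomial n x y I * symbolMonomial n x y J =
          ζ ^ ((I.2 : ℕ) * (J.1 : ℕ)) •
            (y ^ ((I.1 : ℕ) + (J.1 : ℕ)) * x ^ ((I.2 : ℕ) + (J.2 : ℕ))) := by
        simp only [symbolMonomial]
        rw [mul_assoc, ← mul_assoc (x ^ (I.2 : ℕ)), h.x_pow_mul_y_pow, smul_mul_assoc,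
          mul_smul_comm, pow_add, pow_add]
        simp only [mul_assoc]
      rw [this]
      exact Submodule.smul_mem _ _ (h.monomial_mem_span hn _ _)
    · simp
    · simp
    · intro _ _ _ _ _ _ h1 h2; rw [add_mul]; exact Submodule.add_mem _ h1 h2
    · intro _ _ _ _ _ _ h1 h2; rw [mul_add]; exact Submodule.add_mem _ h1 h2
    · intro _ _ _ _ _ h1; rw [smul_mul_assoc]; exact Submodule.smul_mem _ _ h1
    · intro _ _ _ _ _ h1; rw [mul_smul_comm]; exact Submodule.smul_mem _ _ h1

end IsSymbolPair

/-! ### Symbol algebras over commutative rings -/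

/-- The defining relations of the symbol algebra over a commutative ring. -/
inductive SymbolRing.Rel (S : Type u) [CommRing S] (n : ℕ) (ζ a b : S) :
    FreeAlgebra S (Fin 2) → FreeAlgebra S (Fin 2) → Prop
  | x_pow : SymbolRing.Rel S n ζ a b
      (FreeAlgebra.ι S 0 ^ n) (algebraMap S (FreeAlgebra S (Fin 2)) a)
  | y_pow : SymbolRing.Rel S n ζ a b
      (FreeAlgebra.ι S 1 ^ n) (algebraMap S (FreeAlgebra S (Fin 2)) b)
  | x_mul_y : SymbolRing.Rel S n ζ a b
      (FreeAlgebra.ι S 0 * FreeAlgebra.ι S 1)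
      (algebraMap S (FreeAlgebra S (Fin 2)) ζ * (FreeAlgebra.ι S 1 * FreeAlgebra.ι S 0))

/-- The symbol algebra `(a, b)_n` over a commutative ring. -/
def SymbolRing (S : Type u) [CommRing S] (n : ℕ) (ζ a b : S) : Type u :=
  RingQuot (SymbolRing.Rel S n ζ a b)

namespace SymbolRing

variable (S : Type u) [CommRing S] (n : ℕ) (ζ a b : S)

noncomputable instance : Ring (SymbolRing S n ζ a b) :=
  inferInstanceAs (Ring (RingQuot (SymbolRing.Rel S n ζ a b)))

noncomputable instance : Algebra S (SymbolRing S n ζ a b) :=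
  inferInstanceAs (Algebra S (RingQuot (SymbolRing.Rel S n ζ a b)))

/-- The generator `x`. -/
noncomputable def x : SymbolRing S n ζ a b :=
  RingQuot.mkAlgHom S (SymbolRing.Rel S n ζ a b) (FreeAlgebra.ι S 0)

/-- The generator `y`. -/
noncomputable def y : SymbolRing S n ζ a b :=
  RingQuot.mkAlgHom S (SymbolRing.Rel S n ζ a b) (FreeAlgebra.ι S 1)

theorem isSymbolPair : IsSymbolPair n ζ a b (x S n ζ a b) (y S n ζ a b) where
  x_pow := by
    have := RingQuot.mkAlgHom_rel S (Rel.x_pow (S := S) (n := n) (ζ := ζ) (a := a) (b := b))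
    rw [map_pow, AlgHom.commutes] at this
    exact this
  y_pow := by
    have := RingQuot.mkAlgHom_rel S (Rel.y_pow (S := S) (n := n) (ζ := ζ) (a := a) (b := b))
    rw [map_pow, AlgHom.commutes] at this
    exact this
  x_mul_y := by
    have := RingQuot.mkAlgHom_rel S (Rel.x_mul_y (S := S) (n := n) (ζ := ζ) (a := a) (b := b))
    rw [map_mul, map_mul, map_mul, AlgHom.commutes, ← Algebra.smul_def] at this
    exact this

theorem adjoin_eq_top : Algebra.adjoin S {x S n ζ a b, y S n ζ a b} = ⊤ := by
  have h1 : Set.range (FreeAlgebra.ι S : Fin 2 → _) =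
      {FreeAlgebra.ι S 0, FreeAlgebra.ι S 1} := by
    ext z; simp [Fin.exists_fin_two, eq_comm]
  have h2 := congrArg (Subalgebra.map (RingQuot.mkAlgHom S (Rel S n ζ a b)))
    (FreeAlgebra.adjoin_range_ι S (Fin 2))
  rw [h1, AlgHom.map_adjoin, Algebra.map_top, Set.image_pair,
    (AlgHom.range_eq_top _).mpr (RingQuot.mkAlgHom_surjective S _)] at h2
  exact h2

variable {S n ζ a b}

section lift

variable {B : Type*} [Ring B] [Algebra S B] {x' y' : B}

/-- The universal property of the symbol algebra. -/
theorem exists_lift (h : IsSymbolPair n ζ a b x' y') :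
    ∃ f : SymbolRing S n ζ a b →ₐ[S] B, f (x S n ζ a b) = x' ∧ f (y S n ζ a b) = y' := by
  refine ⟨RingQuot.liftAlgHom S ⟨FreeAlgebra.lift S ![x', y'], ?_⟩, ?_, ?_⟩
  · rintro _ _ (_ | _ | _)
    · simp [h.x_pow]
    · simp [h.y_pow]
    · simp [h.x_mul_y, Algebra.smul_def]
  · refine (RingQuot.liftAlgHom_mkAlgHom_apply _ _ _ _).trans ?_
    simp
  · refine (RingQuot.liftAlgHom_mkAlgHom_apply _ _ _ _).trans ?_
    simp

end lift

theorem span_monomial (hn : n ≠ 0) :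
    Submodule.span S (Set.range (symbolMonomial n (x S n ζ a b) (y S n ζ a b))) = ⊤ :=
  (isSymbolPair S n ζ a b).span_monomial hn (adjoin_eq_top S n ζ a b)

end SymbolRing

/-! ### Radical extensions and a faithful model of the symbol relations -/

section AdjoinRoot

open Polynomial

theorem root_pow_eq {S : Type*} [CommRing S] {n : ℕ} (a : S) :
    (AdjoinRoot.root (X ^ n - C a)) ^ n = algebraMap S _ a := by
  have := AdjoinRoot.eval₂_root (X ^ n - C a)
  rw [eval₂_sub, eval₂_X_pow, eval₂_C, sub_eq_zero] at this
  exact this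

variable {S : Type u} [CommRing S] [Nontrivial S] {n : ℕ}

theorem linearIndependent_root_pow (hn : n ≠ 0) (a : S) :
    LinearIndependent S
      (fun i : Fin n => (AdjoinRoot.root (X ^ n - C a)) ^ (i : ℕ)) := by
  have hm : (X ^ n - C a : S[X]).Monic := monic_X_pow_sub_C a hn
  have h := (AdjoinRoot.powerBasis' hm).basis.linearIndependent
  have hd : (AdjoinRoot.powerBasis' hm).dim = n := by
    simp
  rw [PowerBasis.coe_basis] at h
  exact h.comp (Fin.cast hd.symm) (Fin.cast_injective _)

theorem span_root_pow (hn : n ≠ 0) (a : S) :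
    Submodule.span S (Set.range
      (fun i : Fin n => (AdjoinRoot.root (X ^ n - C a)) ^ (i : ℕ))) = ⊤ := by
  have hm : (X ^ n - C a : S[X]).Monic := monic_X_pow_sub_C a hn
  have h := (AdjoinRoot.powerBasis' hm).basis.span_eq
  have hd : (AdjoinRoot.powerBasis' hm).dim = n := by
    simp
  rw [PowerBasis.coe_basis] at h
  rw [← h]
  congr 1
  exact ((finCongr hd.symm).surjective.range_comp
    (fun i => (AdjoinRoot.powerBasis' hm).gen ^ (i : ℕ)))

/-- The power basis of `S[X]/(X ^ n - a)`. -/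
noncomputable def radicalBasis (hn : n ≠ 0) (a : S) :
    Module.Basis (Fin n) S (AdjoinRoot (X ^ n - C a)) :=
  .mk (linearIndependent_root_pow hn a) (span_root_pow hn a).ge

theorem radicalBasis_apply (hn : n ≠ 0) (a : S) (i : Fin n) :
    radicalBasis hn a i = (AdjoinRoot.root (X ^ n - C a)) ^ (i : ℕ) := by
  simp [radicalBasis]

/-- A symbol pair with linearly independent monomials: `x` and `y` act on
`S[Y]/(Y ^ n - b) ⊗ S[X]/(X ^ n - a)`. -/
theorem exists_isSymbolPair_linearIndependent (hn : n ≠ 0) {ζ : S} (hζ : ζ ^ n = 1) (a b : S) :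
    ∃ (B : Type u) (_ : Ring B) (_ : Algebra S B) (x y : B),
      IsSymbolPair n ζ a b x y ∧ LinearIndependent S (symbolMonomial n x y) := by
  set C1 := AdjoinRoot (X ^ n - C b)
  set C2 := AdjoinRoot (X ^ n - C a)
  set Y : C1 := AdjoinRoot.root _
  set Z : C2 := AdjoinRoot.root _
  have hY : Y ^ n = algebraMap S C1 b := root_pow_eq b
  have hZ : Z ^ n = algebraMap S C2 a := root_pow_eq a
  obtain ⟨σ, hσ⟩ : ∃ σ : C1 →ₐ[S] C1, σ Y = ζ • Y :=
    ⟨AdjoinRoot.liftAlgHom _ (Algebra.ofId S C1) (ζ • Y) (by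
      rw [eval₂_sub, eval₂_X_pow, eval₂_C, _root_.smul_pow, hζ, one_smul, hY]
      exact sub_self _), AdjoinRoot.liftAlgHom_root _ _ _ _⟩
  have hσi : ∀ i : ℕ, (σ.toLinearMap ^ i) Y = ζ ^ i • Y := by
    intro i
    induction i with
    | zero => simp
    | succ i ih =>
      rw [pow_succ, Module.End.mul_apply, AlgHom.toLinearMap_apply, hσ, map_smul, ih, smul_smul,
        pow_succ']
  have hσp : ∀ i : ℕ, σ.toLinearMap ^ i = (σ ^ i).toLinearMap := by
    intro i
    induction i with
    | zero => rfl
    | succ i ih => rw [pow_succ, ih, pow_succ]; rfl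
  have hσn : σ.toLinearMap ^ n = 1 := by
    have : σ ^ n = AlgHom.id S C1 := by
      refine AdjoinRoot.algHom_ext ?_
      have := hσi n
      rw [hζ, one_smul, hσp] at this
      exact this
    rw [hσp, this]
    rfl
  -- `σ` and multiplication by `Y` satisfy the commutation rule, but `σ ^ n = 1`; the factor `Z`
  -- turns this into `x ^ n = a`.
  refine ⟨Module.End S C1 ⊗[S] C2, inferInstance, inferInstance,
    σ.toLinearMap ⊗ₜ Z, Algebra.lmul S C1 Y ⊗ₜ 1, ⟨?_, ?_, ?_⟩, ?_⟩
  · rw [Algebra.TensorProduct.tmul_pow, hσn, hZ, Algebra.TensorProduct.algebraMap_apply,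
      Algebra.algebraMap_eq_smul_one, TensorProduct.tmul_smul, Algebra.algebraMap_eq_smul_one,
      TensorProduct.smul_tmul']
  · rw [Algebra.TensorProduct.tmul_pow, ← map_pow, hY, one_pow, AlgHom.commutes]
    rfl
  · rw [Algebra.TensorProduct.tmul_mul_tmul, Algebra.TensorProduct.tmul_mul_tmul, mul_one, one_mul,
      TensorProduct.smul_tmul']
    congr 1
    refine LinearMap.ext fun z => ?_
    change σ (Y * z) = ζ • (Y * σ z)
    rw [map_mul, hσ, smul_mul_assoc]
  -- Since `σ` fixes `1`, evaluation at `1` sends the monomials to the basis `Y ^ i ⊗ Z ^ j`.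
  · let ev : Module.End S C1 →ₗ[S] C1 := LinearMap.applyₗ 1
    refine LinearIndependent.of_comp (TensorProduct.map ev LinearMap.id) ?_
    have : (TensorProduct.map ev LinearMap.id) ∘
        symbolMonomial n (σ.toLinearMap ⊗ₜ[S] Z) (Algebra.lmul S C1 Y ⊗ₜ[S] 1) =
        (radicalBasis hn b).tensorProduct (radicalBasis hn a) := by
      ext ⟨i, j⟩
      simp only [symbolMonomial, Function.comp_apply, Algebra.TensorProduct.tmul_pow, one_pow,
        Algebra.TensorProduct.tmul_mul_tmul, one_mul, TensorProduct.map_tmul, LinearMap.id_apply,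
        Module.Basis.tensorProduct_apply, radicalBasis_apply, hσp, ← map_pow]
      congr 1
      change Y ^ (i : ℕ) * ((σ ^ (j : ℕ)) 1) = Y ^ (i : ℕ)
      rw [map_one, mul_one]
    rw [this]
    exact Module.Basis.linearIndependent _

end AdjoinRoot

namespace SymbolRing

variable {S : Type u} [CommRing S] [Nontrivial S] {n : ℕ} {ζ : S}

/-- The basis of monomials of the symbol algebra. -/
noncomputable def basis (hn : n ≠ 0) (hζ : ζ ^ n = 1) (a b : S) :
    Module.Basis (Fin n × Fin n) S (SymbolRing S n ζ a b) :=
  .mk (v := symbolMonomial n (x S n ζ a b) (y S n ζ a b)) (by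
    obtain ⟨B, _, _, x', y', h, hli⟩ := exists_isSymbolPair_linearIndependent hn hζ a b
    obtain ⟨f, hx, hy⟩ := exists_lift h
    refine LinearIndependent.of_comp f.toLinearMap ?_
    convert hli
    ext I
    simp [symbolMonomial, hx, hy]) (span_monomial hn).ge

theorem basis_apply (hn : n ≠ 0) (hζ : ζ ^ n = 1) (a b : S) (I : Fin n × Fin n) :
    basis hn hζ a b I = y S n ζ a b ^ (I.1 : ℕ) * x S n ζ a b ^ (I.2 : ℕ) := by
  simp [basis, symbolMonomial]

end SymbolRing

/-! ### Transfer of the monomial basis to symbol algebras over a field -/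

namespace SymbolAlgebra

variable (F : Type u) [Field F] (n : ℕ) (ζ a b : F)

/-- The generator `x`. -/
noncomputable def x : SymbolAlgebra F n ζ a b :=
  RingQuot.mkAlgHom F (SymbolAlgebra.Rel F n ζ a b) (FreeAlgebra.ι F 0)

/-- The generator `y`. -/
noncomputable def y : SymbolAlgebra F n ζ a b :=
  RingQuot.mkAlgHom F (SymbolAlgebra.Rel F n ζ a b) (FreeAlgebra.ι F 1)

theorem isSymbolPair : IsSymbolPair n ζ a b (x F n ζ a b) (y F n ζ a b) where
  x_pow := by
    have := RingQuot.mkAlgHom_rel F (Rel.x_pow (F := F) (n := n) (ζ := ζ) (a := a) (b := b))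
    rw [map_pow, AlgHom.commutes] at this
    exact this
  y_pow := by
    have := RingQuot.mkAlgHom_rel F (Rel.y_pow (F := F) (n := n) (ζ := ζ) (a := a) (b := b))
    rw [map_pow, AlgHom.commutes] at this
    exact this
  x_mul_y := by
    have := RingQuot.mkAlgHom_rel F (Rel.x_mul_y (F := F) (n := n) (ζ := ζ) (a := a) (b := b))
    rw [map_mul, map_mul, map_mul, AlgHom.commutes, ← Algebra.smul_def] at this
    exact this

/-- Over a field, `SymbolAlgebra` and `SymbolRing` have the same presentation. -/
theorem exists_algEquiv : ∃ f : SymbolRing F n ζ a b ≃ₐ[F] SymbolAlgebra F n ζ a b,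
    f (SymbolRing.x F n ζ a b) = x F n ζ a b ∧ f (SymbolRing.y F n ζ a b) = y F n ζ a b := by
  have h : SymbolRing.Rel F n ζ a b = SymbolAlgebra.Rel F n ζ a b := by
    ext p q
    constructor
    · rintro (_ | _ | _) <;> constructor
    · rintro (_ | _ | _) <;> constructor
  have key : ∀ r r' : FreeAlgebra F (Fin 2) → FreeAlgebra F (Fin 2) → Prop, r = r' →
      ∃ f : RingQuot r ≃ₐ[F] RingQuot r', ∀ i : Fin 2,
        f (RingQuot.mkAlgHom F r (FreeAlgebra.ι F i)) =
          RingQuot.mkAlgHom F r' (FreeAlgebra.ι F i) := by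
    rintro r _ rfl
    exact ⟨AlgEquiv.refl, fun _ => rfl⟩
  obtain ⟨f, hf⟩ := key _ _ h
  exact ⟨f, hf 0, hf 1⟩

variable {F n ζ}

/-- The basis of monomials of the symbol algebra. -/
noncomputable def basis (hn : n ≠ 0) (hζ : ζ ^ n = 1) (a b : F) :
    Module.Basis (Fin n × Fin n) F (SymbolAlgebra F n ζ a b) :=
  (SymbolRing.basis hn hζ a b).map (exists_algEquiv F n ζ a b).choose.toLinearEquiv

theorem basis_apply (hn : n ≠ 0) (hζ : ζ ^ n = 1) (a b : F) (I : Fin n × Fin n) :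
    basis hn hζ a b I = y F n ζ a b ^ (I.1 : ℕ) * x F n ζ a b ^ (I.2 : ℕ) := by
  have h := (exists_algEquiv F n ζ a b).choose_spec
  simp [basis, SymbolRing.basis_apply, h.1, h.2]

end SymbolAlgebra

/-! ### A symbol algebra over a power series ring -/

/-- Moving the `x`'s to the right collects `ζ ^ (1 + 2 + ⋯ + j)`. For `j = n` and `ζ` primitive over
a domain the scalar is `-1`, so `(-(xy)) ^ n = -ab`; this puts `(a, -ab)_n` inside `(a, b)_n`. -/
theorem IsSymbolPair.neg_mul_pow {S B : Type*} [CommRing S] [Ring B] [Algebra S B] {n : ℕ}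
    {ζ a b : S} {x y : B} (h : IsSymbolPair n ζ a b x y) (j : ℕ) :
    (-(x * y)) ^ j = ((-1) ^ j * ζ ^ ((j + 1) * j / 2)) • (y ^ j * x ^ j) := by
  induction j with
  | zero => simp
  | succ j ih =>
    have h1 : (y ^ j * x ^ j) * (x * y) = ζ ^ (j + 1) • (y ^ (j + 1) * x ^ (j + 1)) := by
      have := h.x_pow_mul_y_pow (j + 1) 1
      rw [pow_one, mul_one] at this
      rw [mul_assoc, ← mul_assoc _ x, ← pow_succ, this, mul_smul_comm, ← mul_assoc, ← pow_succ]
    rw [pow_succ, ih, mul_neg, smul_mul_assoc, h1, smul_smul, ← neg_smul]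
    have h2 : (j + 1 + 1) * (j + 1) / 2 = (j + 1) * j / 2 + (j + 1) := by
      have := Nat.triangle_succ (j + 1)
      simpa using this
    rw [h2]
    congr 1
    ring

/-- For odd `n` the exponent of `ζ` is a multiple of `n`; for `n = 2k` primitivity gives `ζ ^ k =
-1`, raised to the odd power `n + 1`. -/
theorem neg_one_pow_mul_pow_of_isPrimitiveRoot {K : Type*} [CommRing K] [IsDomain K] {n : ℕ}
    (hn : n ≠ 0) {ζ : K} (hζ : IsPrimitiveRoot ζ n) :
    (-1) ^ n * ζ ^ ((n + 1) * n / 2) = -1 := by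
  rcases Nat.even_or_odd' n with ⟨k, rfl | rfl⟩
  · have hk : ζ ^ k = -1 := by
      have h1 : ζ ^ k ≠ 1 := hζ.pow_ne_one_of_pos_of_lt (by lia) (by lia)
      have h2 : (ζ ^ k - 1) * (ζ ^ k + 1) = 0 := by
        have := hζ.pow_eq_one
        rw [two_mul, pow_add] at this
        linear_combination this
      rcases mul_eq_zero.mp h2 with h | h
      · exact absurd (sub_eq_zero.mp h) h1
      · exact eq_neg_of_add_eq_zero_left h
    have : (2 * k + 1) * (2 * k) / 2 = k * (2 * k + 1) := by
      rw [show (2 * k + 1) * (2 * k) = k * (2 * k + 1) * 2 by ring]; simp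
    rw [this, pow_mul ζ, hk, pow_succ (-1 : K) (2 * k), pow_mul (-1 : K)]
    simp
  · have : (2 * k + 1 + 1) * (2 * k + 1) / 2 = (2 * k + 1) * (k + 1) := by
      rw [show (2 * k + 1 + 1) * (2 * k + 1) = (2 * k + 1) * (k + 1) * 2 by ring]; simp
    rw [this, pow_mul ζ, hζ.pow_eq_one, pow_succ (-1 : K) (2 * k), pow_mul (-1 : K)]
    simp

theorem IsSymbolPair.exists_mul_eq {S B : Type*} [CommRing S] [Ring B] [Algebra S B] {n : ℕ}
    {ζ a b : S} {x y : B} (h : IsSymbolPair n ζ a b x y) (hn : n ≠ 0) (hζ : ζ ^ n = 1)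
    (i : ℕ) {j : ℕ}
    (hj : j ≠ 0) : ∃ z, y ^ i * x ^ j = x * z := by
  obtain ⟨j, rfl⟩ := Nat.exists_eq_succ_of_ne_zero hj
  obtain ⟨n, rfl⟩ := Nat.exists_eq_succ_of_ne_zero hn
  -- Here `n` is the predecessor of the original exponent, so `ζ ^ n` is the inverse of `ζ`.
  refine ⟨ζ ^ (n * i) • (y ^ i * x ^ j), ?_⟩
  rw [mul_smul_comm, ← mul_assoc, h.x_mul_y_pow, smul_mul_assoc, smul_smul, ← pow_add,
    ← Nat.succ_mul, pow_mul, hζ, one_pow, one_smul, mul_assoc, ← pow_succ']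

open PowerSeries in
/-- If `X ^ n - c` is irreducible over `k` and `τ` is a uniformizer of `k⟦X⟧`, then the symbol
algebra `(τ, c)_n` over `k⟦X⟧` has no zero divisors. -/
theorem SymbolRing.noZeroDivisors_powerSeries {k : Type u} [Field k] {n : ℕ} (hn : n ≠ 0)
    {ζ : PowerSeries k} (hζ : ζ ^ n = 1) {τ : PowerSeries k} (hτ0 : constantCoeff τ = 0)
    (hτ : τ ∣ X) {c : k}
    (hc : Irreducible (Polynomial.X ^ n - Polynomial.C c : Polynomial k)) :
    NoZeroDivisors (SymbolRing (PowerSeries k) n ζ τ (PowerSeries.C c)) := by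
  have : Fact (Irreducible (Polynomial.X ^ n - Polynomial.C c : Polynomial k)) := ⟨hc⟩
  set k' := AdjoinRoot (Polynomial.X ^ n - Polynomial.C c : Polynomial k)
  -- The residue field `k'` receives scalars through the constant term; as `τ` has none, `x ↦ 0`, `y
  -- ↦ r` respects the relations.
  let _ : Algebra (PowerSeries k) k' := ((algebraMap k k').comp constantCoeff).toAlgebra
  have hsmul : ∀ (s : PowerSeries k) (z : k'), s • z = constantCoeff s • z := by
    intro s z
    rw [Algebra.smul_def, Algebra.smul_def]
    rfl
  set r : k' := AdjoinRoot.root _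
  have hpair : IsSymbolPair n ζ τ (PowerSeries.C c) (0 : k') r := by
    refine ⟨?_, ?_, by simp⟩
    · rw [zero_pow hn, Algebra.algebraMap_eq_smul_one, hsmul, hτ0, zero_smul]
    · rw [root_pow_eq, Algebra.algebraMap_eq_smul_one, Algebra.algebraMap_eq_smul_one, hsmul]
      simp
  obtain ⟨φ, hφx, hφy⟩ := SymbolRing.exists_lift hpair
  have hgen := SymbolRing.isSymbolPair (PowerSeries k) n ζ τ (PowerSeries.C c)
  set e := SymbolRing.basis hn hζ τ (PowerSeries.C c)
  have hτne : τ ≠ 0 := by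
    rintro rfl
    exact X_ne_zero (zero_dvd_iff.mp hτ)
  have hτu : ¬IsUnit τ := by
    intro h
    have := h.map (constantCoeff (R := k))
    rw [hτ0] at this
    exact not_isUnit_zero this
  have hζu : IsUnit ζ := IsUnit.of_pow_eq_one hζ hn
  refine noZeroDivisors_of_normal_element e (SymbolRing.x _ n ζ τ _) n τ hgen.x_pow hτne hτu
    ?_ (φ : _ →+* k') hφx ?_ hn
  · rintro ⟨i, j⟩
    refine ⟨(hζu.unit ^ (i : ℕ))⁻¹, ?_⟩
    rw [eq_inv_smul_iff, SymbolRing.basis_apply, ← mul_assoc, hgen.x_mul_y_pow, mul_assoc,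
      ← pow_succ, pow_succ', smul_mul_assoc, mul_assoc, Units.smul_def]
    simp
  · rintro b hb ⟨i, j⟩
    -- Monomials containing `x` are multiples of `x`. The others map to the basis of powers of `r`,
    -- so their coefficients lose their constant term and are divisible by `X`, hence by `τ`.
    by_cases hj : (j : ℕ) = 0
    · right
      refine hτ.trans (X_dvd_iff.mpr ?_)
      have hsum : ∑ i : Fin n, constantCoeff (e.repr b (i, j)) • radicalBasis hn c i = 0 := by
        rw [← hb]
        conv_rhs => rw [← e.sum_repr b]
        rw [RingHom.coe_coe, map_sum, Fintype.sum_prod_type]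
        refine Finset.sum_congr rfl fun i _ => ?_
        rw [Finset.sum_eq_single j]
        · rw [map_smul, hsmul, SymbolRing.basis_apply, map_mul, map_pow, map_pow, hφx, hφy, hj,
            pow_zero, mul_one, radicalBasis_apply]
        · intro j' _ hj'
          have : (j' : ℕ) ≠ 0 := fun h => hj' (Fin.ext (h.trans hj.symm))
          rw [map_smul, SymbolRing.basis_apply, map_mul, map_pow, map_pow, hφx, zero_pow this,
            mul_zero, smul_zero]
        · simp
      exact Fintype.linearIndependent_iff.mp (radicalBasis hn c).linearIndependent _ hsum i
    · left
      rw [SymbolRing.basis_apply]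
      exact hgen.exists_mul_eq hn hζ i hj

/-! ### Polynomials in `(1 + X) ^ m - 1` -/

-- The exponents in the `i`-th summand are congruent to `i` modulo `m`, so different summands share
-- no monomial.
open Polynomial in
theorem eq_zero_of_sum_X_pow_mul_expand {k : Type*} [CommRing k] {m : ℕ} (P : Fin m → k[X])
    (h : ∑ i : Fin m, X ^ (i : ℕ) * expand k m (P i) = 0) (i : Fin m) : P i = 0 := by
  ext a
  have h1 := congrArg (fun p => coeff p (m * a + i)) h
  simp only [finsetSum_coeff, coeff_zero] at h1
  have hm : 0 < m := i.pos
  rw [Finset.sum_eq_single i, add_comm, add_comm (i : ℕ), coeff_X_pow_mul, mul_comm, coeff_expand_mul hm] at h1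
  · simpa using h1
  · intro j _ hj
    rw [coeff_X_pow_mul', coeff_expand hm]
    split_ifs with h2 h3
    · exfalso
      refine hj (Fin.ext ?_)
      have h4 : (j : ℕ) ≡ m * a + i [MOD m] := (Nat.modEq_iff_dvd' h2).mpr h3
      have h5 : (j : ℕ) ≡ i [MOD m] := by
        refine h4.trans ?_
        simp [Nat.ModEq]
      exact Nat.ModEq.eq_of_lt_of_lt h5 j.2 i.2
    · rfl
    · rfl
  · simp

-- With `w = 1 + X`, the powers `w ^ i`, `i < m`, are independent over `k[w ^ m] = k[w ^ m - 1]`,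
-- and `k[w]` embeds in `k⟦X⟧` by a Taylor shift.
open PowerSeries in
theorem eq_zero_of_sum_aeval_mul_one_add_X_pow {k : Type*} [Field k] {m : ℕ}
    (P : Fin m → Polynomial k)
    (h : ∑ i : Fin m, Polynomial.aeval ((1 + X) ^ m - 1 : PowerSeries k) (P i) *
      (1 + X) ^ (i : ℕ) = 0) (i : Fin m) : P i = 0 := by
  have hm : 0 < m := i.pos
  set P' : Fin m → Polynomial k := fun i => (P i).comp (Polynomial.X - 1)
  have h1 : Polynomial.aeval (1 + X : PowerSeries k)
      (∑ i : Fin m, Polynomial.X ^ (i : ℕ) * Polynomial.expand k m (P' i)) = 0 := by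
    rw [← h, map_sum]
    refine Finset.sum_congr rfl fun i _ => ?_
    rw [map_mul, map_pow, Polynomial.aeval_X, Polynomial.expand_aeval, Polynomial.aeval_comp,
      mul_comm]
    simp
  have hinj : Function.Injective (Polynomial.aeval (1 + X : PowerSeries k) :
      Polynomial k → PowerSeries k) := by
    have h2 : ∀ p : Polynomial k, Polynomial.aeval (1 + X : PowerSeries k) p =
        ((Polynomial.taylor 1 p : Polynomial k) : PowerSeries k) := by
      intro p
      have : (Polynomial.aeval (1 + X : PowerSeries k)) =
          (Polynomial.coeToPowerSeries.algHom (R := k) k).comp (Polynomial.taylorAlgHom 1) := by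
        ext
        simp [Polynomial.coeToPowerSeries.algHom_apply, add_comm]
      rw [this]
      simp [Polynomial.coeToPowerSeries.algHom_apply]
    intro p q hpq
    rw [h2, h2] at hpq
    exact Polynomial.taylor_injective 1 (Polynomial.coe_injective k hpq)
  have h3 := eq_zero_of_sum_X_pow_mul_expand P' (hinj (h1.trans (map_zero _).symm)) i
  have h4 : (P' i).comp (Polynomial.X + 1) = P i := by
    simp [P', Polynomial.comp_assoc]
  rw [← h4, h3, Polynomial.zero_comp]

/-! ### The order over `R[t]` -/

section

open Polynomial

/-- For fixed `i`, the map `j ↦ i + j` modulo `n` permutes the exponents of `x`, and each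
wrap-around costs only a factor `a ≠ 0`. Up to units these are the monomials in `x` and `-(xy)` when
`ζ` is a unit. -/
theorem linearIndependent_monomial_mul {T B : Type*} [CommRing T] [IsDomain T] [Ring B]
    [Algebra T B] {n : ℕ} {ζ a b : T} {x y : B} (h : IsSymbolPair n ζ a b x y) (ha : a ≠ 0)
    (hli : LinearIndependent T (symbolMonomial n x y)) :
    LinearIndependent T
      (fun I : Fin n × Fin n => y ^ (I.1 : ℕ) * x ^ ((I.1 : ℕ) + (I.2 : ℕ))) := by
  rw [Fintype.linearIndependent_iff]
  intro g hg I
  have : NeZero n := ⟨I.1.pos.ne'⟩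
  let σ : Fin n × Fin n → Fin n × Fin n := fun I => (I.1, I.1 + I.2)
  have hσ : Function.Injective σ := by
    rintro ⟨i, j⟩ ⟨i', j'⟩ h
    simp only [σ, Prod.mk.injEq] at h
    obtain ⟨rfl, h⟩ := h
    simpa using h
  have h1 : ∑ I : Fin n × Fin n, (g I * a ^ (((I.1 : ℕ) + (I.2 : ℕ)) / n)) •
      (symbolMonomial n x y ∘ σ) I = 0 := by
    rw [← hg]
    refine Finset.sum_congr rfl fun I _ => ?_
    rw [mul_smul]
    congr 1
    simp only [Function.comp_apply, symbolMonomial, σ, Fin.val_add]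
    conv_rhs => rw [← Nat.div_add_mod ((I.1 : ℕ) + (I.2 : ℕ)) n, pow_add, pow_mul, h.x_pow,
      ← map_pow, ← Algebra.smul_def, mul_smul_comm]
  have h2 := Fintype.linearIndependent_iff.mp (hli.comp σ hσ) _ h1 I
  exact (mul_eq_zero.mp h2).resolve_right (pow_ne_zero _ ha)

/-- Tensoring with `(a, c)_m` preserves the absence of zero divisors if the algebra obtained by
reduction modulo `y` has no zero divisors. -/
theorem noZeroDivisors_tensor_symbolRing {S B Q I : Type*} [CommRing S] [IsDomain S]
    [WfDvdMonoid S] [Ring B] [Algebra S B] [Ring Q] [Algebra S Q] [NoZeroDivisors Q] [Fintype I]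
    (e : Module.Basis I S B) {m : ℕ} (hm : m ≠ 0) {ζ a c : S} (hζ : ζ ^ m = 1) (hc0 : c ≠ 0)
    (hcu : ¬IsUnit c) (φ₁ : B →ₐ[S] Q) {w : Q} (hw : IsSymbolPair m ζ a c w 0)
    (hcomm : ∀ b, Commute (φ₁ b) w)
    (hli : ∀ g : I × Fin m → S, ∑ J, g J • (φ₁ (e J.1) * w ^ (J.2 : ℕ)) = 0 → ∀ J, c ∣ g J) :
    NoZeroDivisors (B ⊗[S] SymbolRing S m ζ a c) := by
  obtain ⟨φ₂, hφ₂x, hφ₂y⟩ := SymbolRing.exists_lift hw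
  -- It suffices to see that `φ₂` sends the two generators, to `w` and `0`, into the centralizer of
  -- the image of `φ₁`.
  have hcomm : ∀ a b, Commute (φ₁ a) (φ₂ b) := by
    intro a b
    have h1 : φ₂.range ≤ Subalgebra.centralizer S (Set.range φ₁) := by
      rw [← Algebra.map_top, ← SymbolRing.adjoin_eq_top, AlgHom.map_adjoin]
      refine Algebra.adjoin_le ?_
      rintro _ ⟨_, rfl | rfl, rfl⟩
      · rintro _ ⟨a, rfl⟩
        rw [hφ₂x]
        exact hcomm a
      · rintro _ ⟨a, rfl⟩
        rw [hφ₂y, mul_zero, zero_mul]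
    exact h1 ⟨b, rfl⟩ _ ⟨a, rfl⟩
  let φ := Algebra.TensorProduct.lift φ₁ φ₂ hcomm
  have hpair := SymbolRing.isSymbolPair S m ζ a c
  have he₂ := SymbolRing.basis_apply hm hζ a c
  set e₂ := SymbolRing.basis hm hζ a c
  set x := SymbolRing.x S m ζ a c
  set y := SymbolRing.y S m ζ a c
  have hζu : IsUnit ζ := IsUnit.of_pow_eq_one hζ hm
  refine noZeroDivisors_of_normal_element (e.tensorProduct e₂) (1 ⊗ₜ y) m c ?_
    hc0 hcu ?_ (φ : _ →+* Q) ?_ ?_ hm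
  · rw [Algebra.TensorProduct.tmul_pow, one_pow, hpair.y_pow, Algebra.algebraMap_eq_smul_one,
      TensorProduct.tmul_smul, Algebra.algebraMap_eq_smul_one]
    rfl
  · rintro ⟨I, l, j⟩
    refine ⟨hζu.unit ^ (j : ℕ), ?_⟩
    have h1 : e₂ (l, j) * y = ζ ^ (j : ℕ) • (y * e₂ (l, j)) := by
      have h2 := hpair.x_pow_mul_y_pow j 1
      rw [pow_one, mul_one] at h2
      rw [he₂, mul_assoc, h2, mul_smul_comm, ← mul_assoc, ← mul_assoc,
        ← pow_succ, pow_succ']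
    rw [Module.Basis.tensorProduct_apply, Algebra.TensorProduct.tmul_mul_tmul,
      Algebra.TensorProduct.tmul_mul_tmul, h1, TensorProduct.tmul_smul, mul_one, one_mul,
      Units.smul_def]
    simp
  · simp [φ, hφ₂y]
  · rintro b hb ⟨I, l, q⟩
    -- Only monomials without `y` survive under `φ`; their coefficients are the ones controlled by
    -- `hli`.
    by_cases hl : (l : ℕ) = 0
    · right
      have hb' : ∑ I, (e.tensorProduct e₂).repr b I • φ (e.tensorProduct e₂ I) = 0 := by
        rw [← hb]
        conv_rhs => rw [← (e.tensorProduct e₂).sum_repr b]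
        rw [RingHom.coe_coe, map_sum]
        exact Finset.sum_congr rfl fun I _ => (map_smul _ _ _).symm
      have hφe : ∀ I l q, φ (e.tensorProduct e₂ (I, l, q)) =
          φ₁ (e I) * (0 ^ (l : ℕ) * w ^ (q : ℕ)) := by
        intro I l q
        rw [Module.Basis.tensorProduct_apply, Algebra.TensorProduct.lift_tmul, he₂, map_mul,
          map_pow, map_pow, hφ₂x, hφ₂y]
      refine hli (fun J => (e.tensorProduct e₂).repr b (J.1, l, J.2)) ?_ (I, q)
      rw [← hb']
      refine (Fintype.sum_prod_type _).trans (Eq.trans ?_ (Fintype.sum_prod_type _).symm)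
      refine Finset.sum_congr rfl fun I _ => Eq.trans ?_ (Fintype.sum_prod_type _).symm
      refine Eq.symm ((Finset.sum_eq_single l ?_ (by simp)).trans ?_)
      · intro l' _ hl'
        have : (l' : ℕ) ≠ 0 := fun h => hl' (Fin.ext (h.trans hl.symm))
        refine Finset.sum_eq_zero fun q _ => ?_
        rw [hφe, zero_pow this, zero_mul, mul_zero, smul_zero]
      · refine Finset.sum_congr rfl fun q _ => ?_
        rw [hφe, hl, pow_zero, one_mul]
    · left
      obtain ⟨l, hlm⟩ := l
      obtain ⟨l', rfl⟩ := Nat.exists_eq_succ_of_ne_zero hl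
      refine ⟨e I ⊗ₜ (y ^ l' * x ^ (q : ℕ)), ?_⟩
      rw [Module.Basis.tensorProduct_apply, he₂, Algebra.TensorProduct.tmul_mul_tmul, one_mul,
        ← mul_assoc, ← pow_succ']

/-- Reduction modulo `π` followed by `t ↦ τ` gives `t + 1` the central `m`-th root `1 + X`. The work
is to show that the resulting map to `Q` kills no more than the multiples of `1 ⊗ y`. -/
theorem noZeroDivisors_symbolRing_tensor_of_pair {R k Q : Type*} [CommRing R] [IsDomain R]
    [IsNoetherianRing R] [Field k] (ρ : R →+* k) {π : R} (hπ0 : π ≠ 0)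
    (hπ : ∀ r, ρ r = 0 ↔ π ∣ r) {n m : ℕ} (hn : n ≠ 0) (hm : m ≠ 0) {ζ₁ ζ₂ : R}
    (hζ₁ : ζ₁ ^ n = 1) (hζ₁' : (-1) ^ n * ζ₁ ^ ((n + 1) * n / 2) = -1) (hζ₂ : ζ₂ ^ m = 1) {μ : R}
    [Ring Q] [Algebra (PowerSeries k) Q] [NoZeroDivisors Q] {τ : PowerSeries k}
    (hτ : τ = (1 + PowerSeries.X) ^ m - 1) (hτ0 : τ ≠ 0) {x z : Q}
    (hxz : IsSymbolPair n (PowerSeries.C (ρ ζ₁)) τ (PowerSeries.C (ρ μ)) x z)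
    (hli : LinearIndependent (PowerSeries k) (symbolMonomial n x z)) :
    NoZeroDivisors (SymbolRing R[X] n (C ζ₁) X (C π - C μ * X) ⊗[R[X]]
      SymbolRing R[X] m (C ζ₂) (X + 1) (C π)) := by
  have hρπ : ρ π = 0 := (hπ π).mpr dvd_rfl
  let f : R[X] →+* PowerSeries k := eval₂RingHom (PowerSeries.C.comp ρ) τ
  have hfC : ∀ r, f (C r) = PowerSeries.C (ρ r) := fun r => by simp [f]
  have hfX : f X = τ := by simp [f]
  have hfa : ∀ p, f p = aeval τ (p.map ρ) := fun p => by
    simp [f, aeval_def, eval₂_map, PowerSeries.algebraMap_eq]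
  set z₁ : PowerSeries k := PowerSeries.C (ρ ζ₁) with hz₁
  have hz₁n : z₁ ^ n = 1 := by rw [hz₁, ← map_pow, ← map_pow, hζ₁, map_one, map_one]
  have hz₁' : (-1) ^ n * z₁ ^ ((n + 1) * n / 2) = -1 := by
    have := congrArg (fun r => PowerSeries.C (ρ r)) hζ₁'
    simpa using this
  let _ : Algebra R[X] Q := ((algebraMap (PowerSeries k) Q).comp f).toAlgebra' fun s q =>
    Algebra.commutes (f s) q
  have hmap : ∀ s : R[X], algebraMap R[X] Q s = algebraMap (PowerSeries k) Q (f s) := fun _ => rfl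
  have hsmul : ∀ (s : R[X]) (q : Q), s • q = f s • q := fun s q => by
    rw [Algebra.smul_def, Algebra.smul_def, hmap]
  -- Since `ρ π = 0`, the second entry reduces to `-μτ`, the `n`-th power of `-(x * z)`.
  have hp₁ : IsSymbolPair n (C ζ₁ : R[X]) X (C π - C μ * X) x (-(x * z)) := by
    refine ⟨?_, ?_, ?_⟩
    · rw [hmap, hfX, hxz.x_pow]
    · rw [hxz.neg_mul_pow, hz₁', hxz.x_pow, hxz.y_pow, hmap, map_sub f, map_mul f, hfC, hfC, hfX,
        hρπ, neg_one_smul]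
      simp
    · rw [hsmul, hfC, ← hz₁, mul_neg, neg_mul, smul_neg, mul_assoc x z x, ← mul_smul_comm,
        ← hxz.x_mul_y]
  have hp₂ : IsSymbolPair m (C ζ₂ : R[X]) (X + 1) (C π)
      (algebraMap (PowerSeries k) Q (1 + PowerSeries.X)) 0 := by
    refine ⟨?_, ?_, by simp⟩
    · rw [← map_pow, hmap, map_add f, map_one f, hfX, hτ, sub_add_cancel]
    · rw [zero_pow hm, hmap, hfC, hρπ, map_zero, map_zero]
  obtain ⟨φ₁, hφ₁x, hφ₁y⟩ := SymbolRing.exists_lift hp₁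
  have hζ₁C : (C ζ₁ : R[X]) ^ n = 1 := by rw [← map_pow, hζ₁, map_one]
  have hζ₂C : (C ζ₂ : R[X]) ^ m = 1 := by rw [← map_pow, hζ₂, map_one]
  refine noZeroDivisors_tensor_symbolRing (SymbolRing.basis hn hζ₁C X (C π - C μ * X)) hm hζ₂C
    (C_ne_zero.mpr hπ0) ?_ φ₁ hp₂ (fun b => (Algebra.commutes _ _).symm) ?_
  · intro h
    have := h.map (mapRingHom ρ)
    simp [hρπ] at this
  · rintro g hg ⟨⟨i, j⟩, q⟩
    -- The relation is regrouped by monomials in `z` and `x`; each coefficient is a unit times a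
    -- combination of powers of `1 + X` over `k[τ]`, so two independence statements apply in turn.
    have h3 : ∑ I : Fin n × Fin n, (((-1) ^ (I.1 : ℕ) * z₁ ^ (((I.1 : ℕ) + 1) * I.1 / 2)) *
        ∑ q : Fin m, f (g (I, q)) * (1 + PowerSeries.X) ^ (q : ℕ)) •
          (z ^ (I.1 : ℕ) * x ^ ((I.1 : ℕ) + (I.2 : ℕ))) = 0 := by
      rw [← hg]
      refine Eq.trans ?_ (Fintype.sum_prod_type _).symm
      refine Finset.sum_congr rfl fun I _ => ?_
      rw [Finset.mul_sum, Finset.sum_smul]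
      refine Finset.sum_congr rfl fun q _ => ?_
      rw [SymbolRing.basis_apply, map_mul, map_pow, map_pow, hφ₁x, hφ₁y, hxz.neg_mul_pow,
        ← map_pow (algebraMap (PowerSeries k) Q), ← Algebra.commutes, ← Algebra.smul_def, hsmul, smul_smul, smul_mul_assoc,
        smul_smul, pow_add, mul_assoc (z ^ (I.1 : ℕ))]
      congr 1
      ring
    have hli' := linearIndependent_monomial_mul hxz hτ0 hli
    rw [Fintype.linearIndependent_iff] at hli'
    have h4 := hli' _ h3 (i, j)
    have h5 : IsUnit ((-1) ^ (i : ℕ) * z₁ ^ (((i : ℕ) + 1) * i / 2)) :=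
      ((isUnit_one.neg).pow _).mul ((IsUnit.of_pow_eq_one hz₁n hn).pow _)
    have h6 := (h5.mul_right_eq_zero).mp h4
    simp only [hfa, hτ] at h6
    have h7 := eq_zero_of_sum_aeval_mul_one_add_X_pow _ h6 q
    rw [C_dvd_iff_dvd_coeff]
    intro d
    rw [← hπ, ← coeff_map, h7, coeff_zero]

/-- The order `(t, π - μ t)_n ⊗ (t + 1, π)_m` over `R[t]` has no zero divisors. -/
theorem noZeroDivisors_symbolRing_tensor {R k : Type*} [CommRing R] [IsDomain R]
    [IsNoetherianRing R] [Field k] (ρ : R →+* k) {π : R} (hπ0 : π ≠ 0)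
    (hπ : ∀ r, ρ r = 0 ↔ π ∣ r) {n m : ℕ} (hn : n ≠ 0) (hm : (m : k) ≠ 0) {ζ₁ ζ₂ : R}
    (hζ₁ : ζ₁ ^ n = 1) (hζ₁' : (-1) ^ n * ζ₁ ^ ((n + 1) * n / 2) = -1) (hζ₂ : ζ₂ ^ m = 1) {μ : R}
    (hμ : Irreducible (X ^ n - C (ρ μ))) :
    NoZeroDivisors (SymbolRing R[X] n (C ζ₁) X (C π - C μ * X) ⊗[R[X]]
      SymbolRing R[X] m (C ζ₂) (X + 1) (C π)) := by
  have hm0 : m ≠ 0 := by rintro rfl; simp at hm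
  obtain ⟨τ, hτdef⟩ : ∃ τ : PowerSeries k, τ = (1 + PowerSeries.X) ^ m - 1 := ⟨_, rfl⟩
  have hτ0 : PowerSeries.constantCoeff τ = 0 := by simp [hτdef]
  -- `τ` is `X` times a geometric sum with constant term `m`, nonzero in `k`.
  have hτ : τ ∣ PowerSeries.X := by
    have h1 : τ = (∑ i ∈ Finset.range m, (1 + PowerSeries.X) ^ i) * PowerSeries.X := by
      have := geom_sum_mul (1 + PowerSeries.X : PowerSeries k) m
      rw [add_sub_cancel_left, ← hτdef] at this
      exact this.symm
    have h2 : IsUnit (∑ i ∈ Finset.range m, (1 + PowerSeries.X : PowerSeries k) ^ i) := by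
      rw [PowerSeries.isUnit_iff_constantCoeff]
      simp [hm]
    obtain ⟨u, hu⟩ := h2
    rw [h1, ← hu]
    simp
  have hτne : τ ≠ 0 := fun h => PowerSeries.X_ne_zero (zero_dvd_iff.mp (h ▸ hτ))
  have hz₁n : (PowerSeries.C (ρ ζ₁)) ^ n = 1 := by
    rw [← map_pow, ← map_pow, hζ₁, map_one, map_one]
  have hQ := SymbolRing.noZeroDivisors_powerSeries hn hz₁n hτ0 hτ hμ
  refine noZeroDivisors_symbolRing_tensor_of_pair ρ hπ0 hπ hn hm0 hζ₁ hζ₁' hζ₂ hτdef hτne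
    (SymbolRing.isSymbolPair _ _ _ _ _) ?_
  have h := (SymbolRing.basis hn hz₁n τ (PowerSeries.C (ρ μ))).linearIndependent
  rwa [show ⇑(SymbolRing.basis hn hz₁n τ (PowerSeries.C (ρ μ))) = symbolMonomial n _ _ from
    funext fun I => SymbolRing.basis_apply _ _ _ _ I] at h

end

/-! ### Passage to the fraction field -/

/-- Carrying a basis to a basis makes `f` injective, and every element of `A` enters the image of
`f` after clearing denominators. -/
theorem noZeroDivisors_of_isFractionRing {S F A B I : Type*} [CommRing S] [IsDomain S] [Field F]
    [Algebra S F] [IsFractionRing S F] [Ring A] [Algebra F A] [Ring B] [Algebra S B]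
    [NoZeroDivisors B] [Fintype I] (e : Module.Basis I S B) (E : Module.Basis I F A) (f : B →+* A)
    (hf : ∀ s b, f (s • b) = algebraMap S F s • f b) (hE : ∀ i, f (e i) = E i) :
    NoZeroDivisors A := by
  classical
  have hfe : ∀ b, f b = ∑ i, algebraMap S F (e.repr b i) • E i := by
    intro b
    conv_lhs => rw [← e.sum_repr b]
    rw [map_sum]
    exact Finset.sum_congr rfl fun i _ => by rw [hf, hE]
  have hinj : ∀ b, f b = 0 → b = 0 := by
    intro b hb
    rw [hfe] at hb
    refine e.ext_elem fun i => ?_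
    have := Fintype.linearIndependent_iff.mp E.linearIndependent _ hb i
    rw [map_zero, Finsupp.zero_apply]
    exact (map_eq_zero_iff _ (IsFractionRing.injective S F)).mp this
  have hclear : ∀ a : A, ∃ s : S, s ≠ 0 ∧ ∃ b, algebraMap S F s • a = f b := by
    intro a
    obtain ⟨s, hs⟩ := IsLocalization.exist_integer_multiples_of_finset (nonZeroDivisors S)
      (Finset.univ.image (E.repr a))
    have hs' : ∀ i, ∃ r : S, algebraMap S F r = (s : S) • E.repr a i := fun i =>
      hs _ (Finset.mem_image_of_mem _ (Finset.mem_univ i))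
    choose r hr using hs'
    refine ⟨s, nonZeroDivisors.ne_zero s.2, ∑ i, r i • e i, ?_⟩
    rw [map_sum]
    conv_lhs => rw [← E.sum_repr a]
    rw [Finset.smul_sum]
    refine Finset.sum_congr rfl fun i _ => ?_
    rw [hf, hE, hr, smul_smul, Algebra.smul_def (s : S)]
  refine ⟨fun {a a'} h => ?_⟩
  obtain ⟨s, hs, b, hb⟩ := hclear a
  obtain ⟨s', hs', b', hb'⟩ := hclear a'
  have h1 : b * b' = 0 := by
    refine hinj _ ?_
    rw [map_mul, ← hb, ← hb', smul_mul_smul_comm, h, smul_zero]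
  have hne : ∀ s : S, s ≠ 0 → algebraMap S F s ≠ 0 := fun s hs =>
    (map_ne_zero_iff _ (IsFractionRing.injective S F)).mpr hs
  rcases mul_eq_zero.mp h1 with rfl | rfl
  · left
    rw [map_zero] at hb
    exact (smul_eq_zero.mp hb).resolve_left (hne s hs)
  · right
    rw [map_zero] at hb'
    exact (smul_eq_zero.mp hb').resolve_left (hne s' hs')

theorem noZeroDivisors_symbolAlgebra_tensor {S F : Type*} [CommRing S] [IsDomain S] [Field F]
    [Algebra S F] [IsFractionRing S F] {n m : ℕ} (hn : n ≠ 0) (hm : m ≠ 0) {ζ₁ ζ₂ a b c d : S}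
    (hζ₁ : ζ₁ ^ n = 1) (hζ₂ : ζ₂ ^ m = 1)
    [NoZeroDivisors (SymbolRing S n ζ₁ a b ⊗[S] SymbolRing S m ζ₂ c d)] {ζ₁' ζ₂' a' b' c' d' : F}
    (h1 : algebraMap S F ζ₁ = ζ₁') (h2 : algebraMap S F ζ₂ = ζ₂') (ha : algebraMap S F a = a')
    (hb : algebraMap S F b = b') (hc : algebraMap S F c = c') (hd : algebraMap S F d = d') :
    NoZeroDivisors (SymbolAlgebra F n ζ₁' a' b' ⊗[F] SymbolAlgebra F m ζ₂' c' d') := by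
  subst h1 h2 ha hb hc hd
  have key : ∀ (n : ℕ) (ζ a b : S) (A : Type _) [Ring A] [Algebra F A] [Algebra S A]
      [IsScalarTower S F A] (x y : A), IsSymbolPair n (algebraMap S F ζ) (algebraMap S F a)
        (algebraMap S F b) x y → IsSymbolPair n ζ a b x y := by
    intro n ζ a b A _ _ _ _ x y h
    refine ⟨?_, ?_, ?_⟩
    · rw [h.x_pow, ← IsScalarTower.algebraMap_apply]
    · rw [h.y_pow, ← IsScalarTower.algebraMap_apply]
    · rw [h.x_mul_y, algebraMap_smul]
  set A₁ := SymbolAlgebra F n (algebraMap S F ζ₁) (algebraMap S F a) (algebraMap S F b)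
  set A₂ := SymbolAlgebra F m (algebraMap S F ζ₂) (algebraMap S F c) (algebraMap S F d)
  let _ : Algebra S (A₁ ⊗[F] A₂) := Algebra.compHom _ (algebraMap S F)
  have : IsScalarTower S F (A₁ ⊗[F] A₂) := IsScalarTower.of_algebraMap_eq fun _ => rfl
  let i₁ : A₁ →ₐ[F] A₁ ⊗[F] A₂ := Algebra.TensorProduct.includeLeft
  let i₂ : A₂ →ₐ[F] A₁ ⊗[F] A₂ := Algebra.TensorProduct.includeRight
  obtain ⟨f₁, hx₁, hy₁⟩ := SymbolRing.exists_lift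
    (key n ζ₁ a b _ _ _ ((SymbolAlgebra.isSymbolPair F n _ _ _).map i₁))
  obtain ⟨f₂, hx₂, hy₂⟩ := SymbolRing.exists_lift
    (key m ζ₂ c d _ _ _ ((SymbolAlgebra.isSymbolPair F m _ _ _).map i₂))
  -- The images of the two orders lie in the two tensor factors, which commute.
  have hr₁ : ∀ z, f₁ z ∈ i₁.range := by
    have : f₁.range ≤ i₁.range.restrictScalars S := by
      rw [← Algebra.map_top, ← SymbolRing.adjoin_eq_top, AlgHom.map_adjoin]
      refine Algebra.adjoin_le ?_
      rintro _ ⟨_, rfl | rfl, rfl⟩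
      · exact ⟨_, hx₁.symm⟩
      · exact ⟨_, hy₁.symm⟩
    exact fun z => this ⟨z, rfl⟩
  have hr₂ : ∀ z, f₂ z ∈ i₂.range := by
    have : f₂.range ≤ i₂.range.restrictScalars S := by
      rw [← Algebra.map_top, ← SymbolRing.adjoin_eq_top, AlgHom.map_adjoin]
      refine Algebra.adjoin_le ?_
      rintro _ ⟨_, rfl | rfl, rfl⟩
      · exact ⟨_, hx₂.symm⟩
      · exact ⟨_, hy₂.symm⟩
    exact fun z => this ⟨z, rfl⟩
  have hcomm : ∀ z w, Commute (f₁ z) (f₂ w) := by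
    intro z w
    obtain ⟨z', hz'⟩ := hr₁ z
    obtain ⟨w', hw'⟩ := hr₂ w
    rw [← hz', ← hw']
    change (z' ⊗ₜ[F] (1 : A₂)) * ((1 : A₁) ⊗ₜ[F] w') = (1 ⊗ₜ w') * (z' ⊗ₜ 1)
    simp
  have hζ₁F : (algebraMap S F ζ₁) ^ n = 1 := by rw [← map_pow, hζ₁, map_one]
  have hζ₂F : (algebraMap S F ζ₂) ^ m = 1 := by rw [← map_pow, hζ₂, map_one]
  refine noZeroDivisors_of_isFractionRing (S := S) (F := F)
    ((SymbolRing.basis hn hζ₁ a b).tensorProduct (SymbolRing.basis hm hζ₂ c d))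
    ((SymbolAlgebra.basis hn hζ₁F (algebraMap S F a) (algebraMap S F b)).tensorProduct
      (SymbolAlgebra.basis hm hζ₂F (algebraMap S F c) (algebraMap S F d)))
    (Algebra.TensorProduct.lift f₁ f₂ hcomm : _ →+* _) ?_ ?_
  · intro s z
    rw [RingHom.coe_coe, map_smul, algebraMap_smul]
  · rintro ⟨I, J⟩
    rw [RingHom.coe_coe, Module.Basis.tensorProduct_apply, Module.Basis.tensorProduct_apply,
      Algebra.TensorProduct.lift_tmul, SymbolRing.basis_apply, SymbolRing.basis_apply,
      SymbolAlgebra.basis_apply, SymbolAlgebra.basis_apply, map_mul, map_mul, map_pow, map_pow,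
      map_pow, map_pow, hx₁, hy₁, hx₂, hy₂]
    simp [i₁, i₂]

/-! ### Tensor products of two symbol algebras -/

/-- `A` has commuting symbol pairs `(x₁, y₁)` and `(x₂, y₂)` whose monomials form the basis `E`. -/
structure IsBisymbolBasis {F A : Type*} [Field F] [Ring A] [Algebra F A] {n m : ℕ}
    (ζ₁ ζ₂ a b c d : F) (x₁ y₁ x₂ y₂ : A)
    (E : Module.Basis ((Fin n × Fin n) × (Fin m × Fin m)) F A) : Prop where
  pair₁ : IsSymbolPair n ζ₁ a b x₁ y₁
  pair₂ : IsSymbolPair m ζ₂ c d x₂ y₂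
  comm_xx : Commute x₁ x₂
  comm_xy : Commute x₁ y₂
  comm_yx : Commute y₁ x₂
  comm_yy : Commute y₁ y₂
  basis_apply : ∀ I, E I = symbolMonomial n x₁ y₁ I.1 * symbolMonomial m x₂ y₂ I.2

theorem exists_isBisymbolBasis {F : Type*} [Field F] {n m : ℕ} (hn : n ≠ 0) (hm : m ≠ 0)
    {ζ₁ ζ₂ : F} (hζ₁ : ζ₁ ^ n = 1) (hζ₂ : ζ₂ ^ m = 1) (a b c d : F) :
    ∃ (x₁ y₁ x₂ y₂ : SymbolAlgebra F n ζ₁ a b ⊗[F] SymbolAlgebra F m ζ₂ c d)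
      (E : Module.Basis ((Fin n × Fin n) × (Fin m × Fin m)) F _),
      IsBisymbolBasis ζ₁ ζ₂ a b c d x₁ y₁ x₂ y₂ E := by
  refine ⟨_, _, _, _,
    (SymbolAlgebra.basis hn hζ₁ a b).tensorProduct (SymbolAlgebra.basis hm hζ₂ c d),
    (SymbolAlgebra.isSymbolPair F n ζ₁ a b).map Algebra.TensorProduct.includeLeft,
    (SymbolAlgebra.isSymbolPair F m ζ₂ c d).map Algebra.TensorProduct.includeRight,
    ?_, ?_, ?_, ?_, ?_⟩
  iterate 4 simp [Commute, SemiconjBy]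
  · rintro ⟨I, J⟩
    rw [Module.Basis.tensorProduct_apply, SymbolAlgebra.basis_apply, SymbolAlgebra.basis_apply]
    simp [symbolMonomial]

namespace IsSymbolPair

variable {S B : Type*} [CommRing S] [Ring B] [Algebra S B] {n : ℕ} {ζ a b : S} {x y : B}

theorem x_pow_mul_monomial (h : IsSymbolPair n ζ a b x y) (r : ℕ) (I : Fin n × Fin n) :
    x ^ r * symbolMonomial n x y I =
      (ζ ^ r) ^ (I.1 : ℕ) • (symbolMonomial n x y I * x ^ r) := by
  rw [symbolMonomial, ← mul_assoc, h.x_pow_mul_y_pow, smul_mul_assoc, mul_assoc, ← pow_add,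
    mul_assoc, ← pow_add, add_comm, pow_mul]

theorem monomial_mul_y_pow (h : IsSymbolPair n ζ a b x y) (r : ℕ) (I : Fin n × Fin n) :
    symbolMonomial n x y I * y ^ r =
      (ζ ^ r) ^ (I.2 : ℕ) • (y ^ r * symbolMonomial n x y I) := by
  rw [symbolMonomial, mul_assoc, h.x_pow_mul_y_pow, mul_smul_comm, ← mul_assoc, ← pow_add,
    ← mul_assoc, ← pow_add, add_comm, mul_comm (I.2 : ℕ), pow_mul]

end IsSymbolPair

/-- The basis consists of eigenvectors for conjugation by `u`, so an element fixed by it has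
coordinates only at eigenvalue `1`. Absence of zero divisors lets `u` be cancelled without an
inverse. -/
theorem repr_eq_zero_of_commute {F A I : Type*} [Field F] [Ring A] [NoZeroDivisors A] [Algebra F A]
    [Fintype I] (E : Module.Basis I F A) {u : A} (hu0 : u ≠ 0) (χ : I → F)
    (hu : ∀ i, u * E i = χ i • (E i * u)) {z : A} (hz : u * z = z * u) (i : I) (hi : χ i ≠ 1) :
    E.repr z i = 0 := by
  have h1 : (∑ i, (E.repr z i * (χ i - 1)) • E i) * u = 0 := by
    have h2 : u * z - z * u = 0 := sub_eq_zero.mpr hz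
    rw [← h2]
    conv_rhs => rw [← E.sum_repr z]
    rw [Finset.mul_sum, Finset.sum_mul, Finset.sum_mul, ← Finset.sum_sub_distrib]
    refine Finset.sum_congr rfl fun i _ => ?_
    rw [mul_smul_comm, hu, smul_mul_assoc, smul_mul_assoc, smul_smul, mul_sub, sub_smul, mul_one]
  have h3 := (mul_eq_zero.mp h1).resolve_right hu0
  have h4 := Fintype.linearIndependent_iff.mp E.linearIndependent _ h3 i
  exact (mul_eq_zero.mp h4).resolve_right (sub_ne_zero.mpr hi)

theorem repr_eq_zero_of_commute' {F A I : Type*} [Field F] [Ring A] [NoZeroDivisors A]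
    [Algebra F A] [Fintype I] (E : Module.Basis I F A) {u : A} (hu0 : u ≠ 0) (χ : I → F)
    (hu : ∀ i, E i * u = χ i • (u * E i)) {z : A} (hz : u * z = z * u) (i : I) (hi : χ i ≠ 1) :
    E.repr z i = 0 := by
  have hχ : ∀ i, χ i ≠ 0 := by
    intro i h
    have := hu i
    have hEi : E i ≠ 0 := E.ne_zero i
    rw [h, zero_smul] at this
    rcases mul_eq_zero.mp this with h | h
    · exact hEi h
    · exact hu0 h
  refine repr_eq_zero_of_commute E hu0 (fun i => (χ i)⁻¹) (fun i => ?_) hz i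
    (by simpa using hi)
  rw [hu, inv_smul_smul₀ (hχ i)]

namespace IsBisymbolBasis

variable {F A : Type*} [Field F] [Ring A] [Algebra F A] {n m : ℕ}
    {ζ₁ ζ₂ a b c d : F} {x₁ y₁ x₂ y₂ : A}
    {E : Module.Basis ((Fin n × Fin n) × (Fin m × Fin m)) F A}

theorem commute_x₁ (h : IsBisymbolBasis ζ₁ ζ₂ a b c d x₁ y₁ x₂ y₂ E)
    (I : Fin m × Fin m) : Commute x₁ (symbolMonomial m x₂ y₂ I) :=
  (h.comm_xy.pow_right _).mul_right (h.comm_xx.pow_right _)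

theorem commute_y₁ (h : IsBisymbolBasis ζ₁ ζ₂ a b c d x₁ y₁ x₂ y₂ E)
    (I : Fin m × Fin m) : Commute y₁ (symbolMonomial m x₂ y₂ I) :=
  (h.comm_yy.pow_right _).mul_right (h.comm_yx.pow_right _)

theorem commute_x₂ (h : IsBisymbolBasis ζ₁ ζ₂ a b c d x₁ y₁ x₂ y₂ E)
    (I : Fin n × Fin n) : Commute x₂ (symbolMonomial n x₁ y₁ I) :=
  (h.comm_yx.symm.pow_right _).mul_right (h.comm_xx.symm.pow_right _)

theorem commute_y₂ (h : IsBisymbolBasis ζ₁ ζ₂ a b c d x₁ y₁ x₂ y₂ E)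
    (I : Fin n × Fin n) : Commute y₂ (symbolMonomial n x₁ y₁ I) :=
  (h.comm_yy.symm.pow_right _).mul_right (h.comm_xy.symm.pow_right _)

/-- Elements commuting with powers of the generators have few nonzero coordinates. -/
theorem dvd_of_commute (h : IsBisymbolBasis ζ₁ ζ₂ a b c d x₁ y₁ x₂ y₂ E)
    [NoZeroDivisors A] (hζ₁ : IsPrimitiveRoot ζ₁ n)
    (hζ₂ : IsPrimitiveRoot ζ₂ m) (hx₁ : x₁ ≠ 0) (hy₁ : y₁ ≠ 0) (hx₂ : x₂ ≠ 0) (hy₂ : y₂ ≠ 0)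
    {r₁ s₁ r₂ s₂ : ℕ} {z : A} (hzx₁ : Commute (x₁ ^ r₁) z) (hzy₁ : Commute (y₁ ^ s₁) z)
    (hzx₂ : Commute (x₂ ^ r₂) z) (hzy₂ : Commute (y₂ ^ s₂) z) (I) (hI : E.repr z I ≠ 0) :
    (n ∣ r₁ * I.1.1 ∧ n ∣ s₁ * I.1.2) ∧ (m ∣ r₂ * I.2.1 ∧ m ∣ s₂ * I.2.2) := by
  have : Nontrivial A := nontrivial_of_ne _ _ hx₁
  simp only [← hζ₁.pow_eq_one_iff_dvd, ← hζ₂.pow_eq_one_iff_dvd, pow_mul]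
  refine ⟨⟨?_, ?_⟩, ?_, ?_⟩
  · by_contra hne
    refine hI (repr_eq_zero_of_commute E (pow_ne_zero r₁ hx₁) (fun I => (ζ₁ ^ r₁) ^ (I.1.1 : ℕ))
      (fun I => ?_) hzx₁ I hne)
    rw [h.basis_apply, ← mul_assoc, h.pair₁.x_pow_mul_monomial, smul_mul_assoc, mul_assoc,
      ((h.commute_x₁ I.2).pow_left r₁).eq, mul_assoc]
  · by_contra hne
    refine hI (repr_eq_zero_of_commute' E (pow_ne_zero s₁ hy₁) (fun I => (ζ₁ ^ s₁) ^ (I.1.2 : ℕ))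
      (fun I => ?_) hzy₁ I hne)
    rw [h.basis_apply, mul_assoc, ← ((h.commute_y₁ I.2).pow_left s₁).eq, ← mul_assoc,
      h.pair₁.monomial_mul_y_pow, smul_mul_assoc, mul_assoc]
  · by_contra hne
    refine hI (repr_eq_zero_of_commute E (pow_ne_zero r₂ hx₂) (fun I => (ζ₂ ^ r₂) ^ (I.2.1 : ℕ))
      (fun I => ?_) hzx₂ I hne)
    rw [h.basis_apply, ← mul_assoc, ((h.commute_x₂ I.1).pow_left r₂).eq, mul_assoc,
      h.pair₂.x_pow_mul_monomial, mul_smul_comm, mul_assoc]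
  · by_contra hne
    refine hI (repr_eq_zero_of_commute' E (pow_ne_zero s₂ hy₂) (fun I => (ζ₂ ^ s₂) ^ (I.2.2 : ℕ))
      (fun I => ?_) hzy₂ I hne)
    rw [h.basis_apply, mul_assoc, h.pair₂.monomial_mul_y_pow, mul_smul_comm, ← mul_assoc,
      ← ((h.commute_y₂ I.1).pow_left s₂).eq, mul_assoc]

theorem ne_zero (h : IsBisymbolBasis ζ₁ ζ₂ a b c d x₁ y₁ x₂ y₂ E)
    (hn : n ≠ 0) (hm : m ≠ 0) (ha : a ≠ 0) (hb : b ≠ 0) (hc : c ≠ 0) (hd : d ≠ 0) :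
    (x₁ ≠ 0 ∧ y₁ ≠ 0) ∧ (x₂ ≠ 0 ∧ y₂ ≠ 0) := by
  have : Nonempty ((Fin n × Fin n) × (Fin m × Fin m)) :=
    ⟨⟨⟨0, Nat.pos_of_ne_zero hn⟩, ⟨0, Nat.pos_of_ne_zero hn⟩⟩,
      ⟨⟨0, Nat.pos_of_ne_zero hm⟩, ⟨0, Nat.pos_of_ne_zero hm⟩⟩⟩
  have : Nontrivial A := nontrivial_of_ne _ _ (E.ne_zero (Classical.arbitrary _))
  have key : ∀ {x : A} {k : ℕ} {a : F}, k ≠ 0 → a ≠ 0 → x ^ k = algebraMap F A a → x ≠ 0 := by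
    rintro x k a hk ha hx rfl
    rw [zero_pow hk, eq_comm, map_eq_zero_iff _ (algebraMap F A).injective] at hx
    exact ha hx
  exact ⟨⟨key hn ha h.pair₁.x_pow, key hn hb h.pair₁.y_pow⟩,
    ⟨key hm hc h.pair₂.x_pow, key hm hd h.pair₂.y_pow⟩⟩

theorem isCentralDivisionAlgebra (h : IsBisymbolBasis ζ₁ ζ₂ a b c d x₁ y₁ x₂ y₂ E)
    [NoZeroDivisors A] (hn : n ≠ 0) (hm : m ≠ 0)
    (hζ₁ : IsPrimitiveRoot ζ₁ n) (hζ₂ : IsPrimitiveRoot ζ₂ m) (ha : a ≠ 0) (hb : b ≠ 0)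
    (hc : c ≠ 0) (hd : d ≠ 0) : IsCentralDivisionAlgebra F A := by
  obtain ⟨⟨hx₁, hy₁⟩, hx₂, hy₂⟩ := h.ne_zero hn hm ha hb hc hd
  have hfin : FiniteDimensional F A := Module.Finite.of_basis E
  have hnt : Nontrivial A := nontrivial_of_ne _ _ hx₁
  refine ⟨hfin, ⟨fun z hz => ?_⟩, hnt, fun z hz => ?_⟩
  · rw [Subalgebra.mem_center_iff] at hz
    let I₀ : (Fin n × Fin n) × (Fin m × Fin m) :=
      ⟨⟨⟨0, Nat.pos_of_ne_zero hn⟩, ⟨0, Nat.pos_of_ne_zero hn⟩⟩,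
        ⟨⟨0, Nat.pos_of_ne_zero hm⟩, ⟨0, Nat.pos_of_ne_zero hm⟩⟩⟩
    have hI : ∀ I, I ≠ I₀ → E.repr z I = 0 := by
      rintro ⟨⟨i, j⟩, k, l⟩ hne
      by_contra h0
      -- Commuting with the generators themselves forces every exponent, being below `n` or `m`, to
      -- vanish.
      obtain ⟨⟨h1, h2⟩, h3, h4⟩ := h.dvd_of_commute hζ₁ hζ₂ hx₁ hy₁ hx₂ hy₂ (r₁ := 1) (s₁ := 1)
        (r₂ := 1) (s₂ := 1) (hz _) (hz _) (hz _) (hz _) _ h0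
      simp only [one_mul] at h1 h2 h3 h4
      refine hne ?_
      simp only [I₀, Prod.mk.injEq, Fin.ext_iff]
      exact ⟨⟨Nat.eq_zero_of_dvd_of_lt h1 i.2, Nat.eq_zero_of_dvd_of_lt h2 j.2⟩,
        Nat.eq_zero_of_dvd_of_lt h3 k.2, Nat.eq_zero_of_dvd_of_lt h4 l.2⟩
    have h1 : z = E.repr z I₀ • E I₀ := by
      conv_lhs => rw [← E.sum_repr z]
      refine Finset.sum_eq_single I₀ (fun I _ hne => by rw [hI I hne, zero_smul]) (by simp)
    rw [Algebra.mem_bot]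
    refine ⟨E.repr z I₀, ?_⟩
    conv_rhs => rw [h1]
    rw [h.basis_apply, Algebra.algebraMap_eq_smul_one]
    simp [I₀, symbolMonomial]
  · have hinj : Function.Injective (LinearMap.mulLeft F z) := by
      rw [← LinearMap.ker_eq_bot, LinearMap.ker_eq_bot']
      exact fun w hw => (mul_eq_zero.mp hw).resolve_left hz
    obtain ⟨w, hw⟩ := (LinearMap.injective_iff_surjective.mp hinj) 1
    have hw1 : z * w = 1 := hw
    refine ⟨⟨z, w, hw1, ?_⟩, rfl⟩
    have : z * (w * z - 1) = 0 := by rw [mul_sub, ← mul_assoc, hw1, one_mul, mul_one, sub_self]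
    exact sub_eq_zero.mp ((mul_eq_zero.mp this).resolve_left hz)

end IsBisymbolBasis

/-! ### Kummer extensions generated by several radicals -/

/-- The quotient `σ w / w` is a `d`-th root of unity, hence a power of `η`; as `η` lies in `F` and
is fixed by `σ`, exponents add. -/
theorem exists_kummer_character {F L : Type*} [Field F] [Field L] [Algebra F L] {d : ℕ}
    (hd : d ≠ 0) {η : F} (hη : IsPrimitiveRoot η d) {w : L} (hw0 : w ≠ 0) {c : F}
    (hw : w ^ d = algebraMap F L c) :
    ∃ χ : Gal(L/F) →* Multiplicative (ZMod d),
      ∀ σ, σ w = algebraMap F L (η ^ (Multiplicative.toAdd (χ σ)).val) * w := by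
  have : NeZero d := ⟨hd⟩
  have hηL : IsPrimitiveRoot (algebraMap F L η) d := hη.map_of_injective (algebraMap F L).injective
  have hex : ∀ σ : Gal(L/F), ∃ k : ZMod d, σ w = algebraMap F L (η ^ k.val) * w := by
    intro σ
    have h1 : (σ w / w) ^ d = 1 := by
      rw [div_pow, ← map_pow, hw, AlgEquiv.commutes, div_self]
      rw [← hw]
      exact pow_ne_zero _ hw0
    obtain ⟨i, hi, h2⟩ := hηL.eq_pow_of_pow_eq_one h1
    refine ⟨i, ?_⟩
    rw [ZMod.val_cast_of_lt hi, map_pow, h2, div_mul_cancel₀ _ hw0]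
  choose k hk using hex
  have huniq : ∀ k k' : ZMod d,
      algebraMap F L (η ^ k.val) * w = algebraMap F L (η ^ k'.val) * w → k = k' := by
    intro k k' h
    have h1 := (algebraMap F L).injective (mul_right_cancel₀ hw0 h)
    exact ZMod.val_injective d (hη.pow_inj (ZMod.val_lt k) (ZMod.val_lt k') h1)
  refine ⟨MonoidHom.mk' (fun σ => Multiplicative.ofAdd (k σ)) fun σ τ => ?_, hk⟩
  rw [← ofAdd_add]
  congr 1
  refine huniq _ _ ?_
  rw [← hk, AlgEquiv.mul_apply, hk τ, map_mul, AlgEquiv.commutes, hk σ, ← mul_assoc, ← map_mul,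
    ← pow_add, ZMod.val_add, ← pow_mod_orderOf, ← hη.eq_orderOf, add_comm]

/-- Each `X ^ d - c` splits in `L`, and is separable because a primitive `d`-th root of unity in `F`
forces `d ≠ 0` there. -/
theorem isGalois_of_radicals {F L ι : Type*} [Field F] [Field L] [Algebra F L]
    [FiniteDimensional F L] {d : ι → ℕ} (hd : ∀ i, d i ≠ 0) {η : ι → F}
    (hη : ∀ i, IsPrimitiveRoot (η i) (d i)) {w : ι → L} (hw0 : ∀ i, w i ≠ 0) {c : ι → F}
    (hw : ∀ i, w i ^ d i = algebraMap F L (c i)) (hgen : Algebra.adjoin F (Set.range w) = ⊤) :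
    IsGalois F L := by
  have htop : IntermediateField.adjoin F (Set.range w) = ⊤ := by
    rw [← IntermediateField.toSubalgebra_inj, IntermediateField.adjoin_toSubalgebra, hgen,
      IntermediateField.top_toSubalgebra]
  have hdvd : ∀ i, minpoly F (w i) ∣ Polynomial.X ^ d i - Polynomial.C (c i) := by
    intro i
    refine minpoly.dvd F _ ?_
    simp [hw]
  refine isGalois_iff.mpr ⟨?_, ?_⟩
  · have : Algebra.IsSeparable F (⊤ : IntermediateField F L) := by
      rw [← htop, IntermediateField.isSeparable_adjoin_iff_isSeparable]
      rintro _ ⟨i, rfl⟩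
      have hc : c i ≠ 0 := by
        intro h
        have := hw i
        rw [h, map_zero] at this
        exact pow_ne_zero _ (hw0 i) this
      have : NeZero (d i) := ⟨hd i⟩
      exact (Polynomial.separable_X_pow_sub_C (c i) (hη i).neZero'.out hc).of_dvd (hdvd i)
    exact AlgEquiv.Algebra.isSeparable IntermediateField.topEquiv
  · rw [normal_iff]
    intro x
    refine ⟨Algebra.IsIntegral.isIntegral x, ?_⟩
    have hx : x ∈ IntermediateField.adjoin F (Set.range w) := by
      rw [htop]
      exact IntermediateField.mem_top
    refine IntermediateField.splits_of_mem_adjoin F L ?_ hx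
    rintro _ ⟨i, rfl⟩
    refine ⟨Algebra.IsIntegral.isIntegral _, ?_⟩
    have h1 : ((Polynomial.X ^ d i - Polynomial.C (c i)).map (algebraMap F L)).Splits := by
      rw [Polynomial.map_sub, Polynomial.map_pow, Polynomial.map_X, Polynomial.map_C]
      exact X_pow_sub_C_splits_of_isPrimitiveRoot
        ((hη i).map_of_injective (algebraMap F L).injective) (hw i)
    refine h1.of_dvd ?_ (Polynomial.map_dvd _ (hdvd i))
    exact Polynomial.map_ne_zero (Polynomial.X_pow_sub_C_ne_zero (Nat.pos_of_ne_zero (hd i)) _)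

/-- A Kummer extension of maximal degree has the product of cyclic groups as Galois group. -/
theorem nonempty_mulEquiv_of_radicals {F L ι : Type*} [Field F] [Field L] [Algebra F L]
    [FiniteDimensional F L] [Fintype ι] {d : ι → ℕ} (hd : ∀ i, d i ≠ 0) {η : ι → F}
    (hη : ∀ i, IsPrimitiveRoot (η i) (d i)) {w : ι → L} (hw0 : ∀ i, w i ≠ 0) {c : ι → F}
    (hw : ∀ i, w i ^ d i = algebraMap F L (c i)) (hgen : Algebra.adjoin F (Set.range w) = ⊤)
    (hdim : ∏ i, d i ≤ Module.finrank F L) :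
    Nonempty (Gal(L/F) ≃* ((i : ι) → Multiplicative (ZMod (d i)))) := by
  have := isGalois_of_radicals hd hη hw0 hw hgen
  have : ∀ i, NeZero (d i) := fun i => ⟨hd i⟩
  choose χ hχ using fun i => exists_kummer_character (hd i) (hη i) (hw0 i) (hw i)
  have hinj : Function.Injective (MonoidHom.pi χ) := by
    intro σ τ h
    have h1 : (σ : L →ₐ[F] L) = τ := by
      refine AlgHom.ext_of_adjoin_eq_top hgen ?_
      rintro _ ⟨i, rfl⟩
      have := congrFun h i
      simp only [MonoidHom.pi_apply] at this
      change σ (w i) = τ (w i)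
      rw [hχ, hχ, this]
    exact AlgEquiv.ext fun x => DFunLike.congr_fun h1 x
  refine ⟨MulEquiv.ofBijective (MonoidHom.pi χ) ?_⟩
  have : Finite ((i : ι) → Multiplicative (ZMod (d i))) :=
    inferInstanceAs (Finite ((i : ι) → ZMod (d i)))
  -- The Kummer characters are jointly injective; the degree bound supplies the reverse inequality
  -- of orders.
  refine (Nat.bijective_iff_injective_and_card _).mpr ⟨hinj, ?_⟩
  refine le_antisymm (Nat.card_le_card_of_injective _ hinj) ?_
  rw [IsGalois.card_aut_eq_finrank]
  refine le_trans (le_of_eq ?_) hdim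
  rw [Nat.card_pi]
  exact Finset.prod_congr rfl fun i _ => Nat.card_zmod (d i)

theorem nonempty_mulEquiv_zmod_prod (d : Fin 4 → ℕ) :
    Nonempty (((i : Fin 4) → Multiplicative (ZMod (d i))) ≃*
      Multiplicative (ZMod (d 0) × ZMod (d 1) × ZMod (d 2) × ZMod (d 3))) :=
  ⟨{  toFun := fun f => Multiplicative.ofAdd ((f 0).toAdd, (f 1).toAdd, (f 2).toAdd, (f 3).toAdd)
      invFun := fun p i => Multiplicative.ofAdd (match i with
        | 0 => p.toAdd.1
        | 1 => p.toAdd.2.1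
        | 2 => p.toAdd.2.2.1
        | 3 => p.toAdd.2.2.2)
      left_inv := fun f => by
        funext i
        fin_cases i <;> rfl
      right_inv := fun _ => rfl
      map_mul' := fun _ _ => rfl }⟩

/-! ### The maximal subfield -/

namespace IsBisymbolBasis

variable {F : Type u} {A : Type v} [Field F] [Ring A] [Algebra F A]
    {ζ₁ ζ₂ a b c d : F} {x₁ y₁ x₂ y₂ : A}

/-- Commuting with `x₁ ^ l₁` restricts the exponents of `y₁` to multiples of `l₂`, and symmetrically
for the others. Only monomials in the four chosen powers remain: their algebra contains its
centralizer. -/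
theorem mem_adjoin_of_commute [NoZeroDivisors A] {n m l₁ l₂ l₃ l₄ : ℕ}
    {E : Module.Basis ((Fin n × Fin n) × (Fin m × Fin m)) F A}
    (h : IsBisymbolBasis ζ₁ ζ₂ a b c d x₁ y₁ x₂ y₂ E) (hn : n = l₁ * l₂) (hm : m = l₃ * l₄)
    (hn0 : n ≠ 0) (hm0 : m ≠ 0) (hζ₁ : IsPrimitiveRoot ζ₁ n) (hζ₂ : IsPrimitiveRoot ζ₂ m)
    (hx₁ : x₁ ≠ 0) (hy₁ : y₁ ≠ 0) (hx₂ : x₂ ≠ 0) (hy₂ : y₂ ≠ 0) {z : A}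
    (hzx₁ : Commute (x₁ ^ l₁) z) (hzy₁ : Commute (y₁ ^ l₂) z)
    (hzx₂ : Commute (x₂ ^ l₃) z) (hzy₂ : Commute (y₂ ^ l₄) z) :
    z ∈ Algebra.adjoin F (Set.range ![y₁ ^ l₂, x₁ ^ l₁, y₂ ^ l₄, x₂ ^ l₃]) := by
  subst hn hm
  have key : ∀ (x : A) (r i : ℕ), (∃ j, x ^ r = ![y₁ ^ l₂, x₁ ^ l₁, y₂ ^ l₄, x₂ ^ l₃] j) →
      r ∣ i → x ^ i ∈ Algebra.adjoin F (Set.range ![y₁ ^ l₂, x₁ ^ l₁, y₂ ^ l₄, x₂ ^ l₃]) := by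
    rintro x r _ ⟨j, hj⟩ ⟨k, rfl⟩
    rw [pow_mul, hj]
    exact Subalgebra.pow_mem _ (Algebra.subset_adjoin (Set.mem_range_self j)) _
  rw [← E.sum_repr z]
  refine Subalgebra.sum_mem _ fun I _ => ?_
  by_cases h0 : E.repr z I = 0
  · rw [h0, zero_smul]
    exact Subalgebra.zero_mem _
  · obtain ⟨⟨h1, h2⟩, h3, h4⟩ :=
      h.dvd_of_commute hζ₁ hζ₂ hx₁ hy₁ hx₂ hy₂ hzx₁ hzy₁ hzx₂ hzy₂ I h0
    have hl₁ := Nat.pos_of_ne_zero (left_ne_zero_of_mul hn0)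
    have hl₂ := Nat.pos_of_ne_zero (right_ne_zero_of_mul hn0)
    have hl₃ := Nat.pos_of_ne_zero (left_ne_zero_of_mul hm0)
    have hl₄ := Nat.pos_of_ne_zero (right_ne_zero_of_mul hm0)
    refine Subalgebra.smul_mem _ ?_ _
    rw [h.basis_apply]
    refine Subalgebra.mul_mem _ (Subalgebra.mul_mem _ ?_ ?_) (Subalgebra.mul_mem _ ?_ ?_)
    · exact key _ l₂ _ ⟨0, rfl⟩ (Nat.dvd_of_mul_dvd_mul_left hl₁ h1)
    · exact key _ l₁ _ ⟨1, rfl⟩ (Nat.dvd_of_mul_dvd_mul_left hl₂ ((dvd_of_eq (mul_comm l₂ l₁)).trans h2))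
    · exact key _ l₄ _ ⟨2, rfl⟩ (Nat.dvd_of_mul_dvd_mul_left hl₃ h3)
    · exact key _ l₃ _ ⟨3, rfl⟩ (Nat.dvd_of_mul_dvd_mul_left hl₄ ((dvd_of_eq (mul_comm l₄ l₃)).trans h4))

/-- These products are distinct members of the basis `E`; they bound the degree of the subfield from
below. -/
theorem linearIndependent_subfield {n m l₁ l₂ l₃ l₄ : ℕ}
    {E : Module.Basis ((Fin n × Fin n) × (Fin m × Fin m)) F A}
    (h : IsBisymbolBasis ζ₁ ζ₂ a b c d x₁ y₁ x₂ y₂ E) (hn : n = l₁ * l₂) (hm : m = l₃ * l₄)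
    (hn0 : n ≠ 0) (hm0 : m ≠ 0) :
    LinearIndependent F (fun I : (Fin l₁ × Fin l₂) × (Fin l₃ × Fin l₄) =>
      ((y₁ ^ l₂) ^ (I.1.1 : ℕ) * (x₁ ^ l₁) ^ (I.1.2 : ℕ)) *
        ((y₂ ^ l₄) ^ (I.2.1 : ℕ) * (x₂ ^ l₃) ^ (I.2.2 : ℕ))) := by
  subst hn hm
  have hl₁ := Nat.pos_of_ne_zero (left_ne_zero_of_mul hn0)
  have hl₂ := Nat.pos_of_ne_zero (right_ne_zero_of_mul hn0)
  have hl₃ := Nat.pos_of_ne_zero (left_ne_zero_of_mul hm0)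
  have hl₄ := Nat.pos_of_ne_zero (right_ne_zero_of_mul hm0)
  have hlt : ∀ {p q i : ℕ}, 0 < q → i < p → q * i < p * q := fun hq hi => by
    rw [mul_comm]; exact Nat.mul_lt_mul_of_pos_right hi hq
  have hlt' : ∀ {p q i : ℕ}, 0 < p → i < q → p * i < p * q := fun hq hi =>
    Nat.mul_lt_mul_of_pos_left hi hq
  let g : (Fin l₁ × Fin l₂) × (Fin l₃ × Fin l₄) →
      (Fin (l₁ * l₂) × Fin (l₁ * l₂)) × (Fin (l₃ * l₄) × Fin (l₃ * l₄)) := fun I =>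
    ⟨⟨⟨l₂ * I.1.1, hlt hl₂ I.1.1.2⟩, ⟨l₁ * I.1.2, hlt' hl₁ I.1.2.2⟩⟩,
      ⟨⟨l₄ * I.2.1, hlt hl₄ I.2.1.2⟩, ⟨l₃ * I.2.2, hlt' hl₃ I.2.2.2⟩⟩⟩
  have hg : Function.Injective g := by
    rintro ⟨⟨i, j⟩, k, l⟩ ⟨⟨i', j'⟩, k', l'⟩ h
    simp only [g, Prod.mk.injEq, Fin.ext_iff, mul_eq_mul_left_iff] at h ⊢
    omega
  have := E.linearIndependent.comp g hg
  convert this using 1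
  ext I
  simp [h.basis_apply, symbolMonomial, g, pow_mul]

open scoped IsMulCommutative in
theorem hasMaximalGaloisSubfield [NoZeroDivisors A] {n m l₁ l₂ l₃ l₄ : ℕ}
    {E : Module.Basis ((Fin n × Fin n) × (Fin m × Fin m)) F A}
    (h : IsBisymbolBasis ζ₁ ζ₂ a b c d x₁ y₁ x₂ y₂ E) (hn : n = l₁ * l₂) (hm : m = l₃ * l₄)
    (hn0 : n ≠ 0) (hm0 : m ≠ 0) (hζ₁ : IsPrimitiveRoot ζ₁ n) (hζ₂ : IsPrimitiveRoot ζ₂ m)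
    (ha : a ≠ 0) (hb : b ≠ 0) (hc : c ≠ 0) (hd : d ≠ 0) :
    HasMaximalGaloisSubfield F A
      (Multiplicative (ZMod l₁ × ZMod l₂ × ZMod l₃ × ZMod l₄)) := by
  obtain ⟨⟨hx₁, hy₁⟩, hx₂, hy₂⟩ := h.ne_zero hn0 hm0 ha hb hc hd
  have hfin : FiniteDimensional F A := Module.Finite.of_basis E
  have hnt : Nontrivial A := nontrivial_of_ne _ _ hx₁
  have hl₁ : l₁ ≠ 0 := left_ne_zero_of_mul (hn ▸ hn0)
  have hl₂ : l₂ ≠ 0 := right_ne_zero_of_mul (hn ▸ hn0)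
  have hl₃ : l₃ ≠ 0 := left_ne_zero_of_mul (hm ▸ hm0)
  have hl₄ : l₄ ≠ 0 := right_ne_zero_of_mul (hm ▸ hm0)
  -- The order is chosen so that the exponents `l₁, l₂, l₃, l₄` give elements of `F`. Each pair
  -- commutes since `ζ₁ ^ (l₁ * l₂) = 1` and `ζ₂ ^ (l₃ * l₄) = 1`.
  set w : Fin 4 → A := ![y₁ ^ l₂, x₁ ^ l₁, y₂ ^ l₄, x₂ ^ l₃]
  have hxy₁ : Commute (x₁ ^ l₁) (y₁ ^ l₂) := by
    have := h.pair₁.x_pow_mul_y_pow l₁ l₂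
    rwa [← hn, hζ₁.pow_eq_one, one_smul] at this
  have hxy₂ : Commute (x₂ ^ l₃) (y₂ ^ l₄) := by
    have := h.pair₂.x_pow_mul_y_pow l₃ l₄
    rwa [← hm, hζ₂.pow_eq_one, one_smul] at this
  have hxx := h.comm_xx.pow_pow l₁ l₃
  have hxy := h.comm_xy.pow_pow l₁ l₄
  have hyx := h.comm_yx.pow_pow l₂ l₃
  have hyy := h.comm_yy.pow_pow l₂ l₄
  have hcomm : ∀ i j, Commute (w i) (w j) := by
    intro i j
    fin_cases i <;> fin_cases j <;>
      first
      | exact Commute.refl _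
      | assumption
      | (apply Commute.symm; assumption)
  let L : Subalgebra F A := Algebra.adjoin F (Set.range w)
  have hmc : IsMulCommutative L := Algebra.isMulCommutative_adjoin F (by
    rintro _ ⟨i, rfl⟩ _ ⟨j, rfl⟩
    exact hcomm i j)
  have hLfin : FiniteDimensional F L := inferInstance
  have hdom : IsDomain L := { }
  let _ : Field L := fieldOfFiniteDimensional F L
  let w' : Fin 4 → L := fun i => ⟨w i, Algebra.subset_adjoin ⟨i, rfl⟩⟩
  have hw0 : ∀ i, w i ≠ 0 := by
    intro i
    fin_cases i
    · exact pow_ne_zero _ hy₁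
    · exact pow_ne_zero _ hx₁
    · exact pow_ne_zero _ hy₂
    · exact pow_ne_zero _ hx₂
  have hw0' : ∀ i, w' i ≠ 0 := fun i h0 => hw0 i (congrArg Subtype.val h0)
  have hpow : ∀ i, w i ^ ![l₁, l₂, l₃, l₄] i = algebraMap F A (![b, a, d, c] i) := by
    intro i
    fin_cases i
    · change (y₁ ^ l₂) ^ l₁ = algebraMap F A b
      rw [← pow_mul, mul_comm, ← hn, h.pair₁.y_pow]
    · change (x₁ ^ l₁) ^ l₂ = algebraMap F A a
      rw [← pow_mul, ← hn, h.pair₁.x_pow]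
    · change (y₂ ^ l₄) ^ l₃ = algebraMap F A d
      rw [← pow_mul, mul_comm, ← hm, h.pair₂.y_pow]
    · change (x₂ ^ l₃) ^ l₄ = algebraMap F A c
      rw [← pow_mul, ← hm, h.pair₂.x_pow]
  have hpow' : ∀ i, w' i ^ ![l₁, l₂, l₃, l₄] i = algebraMap F L (![b, a, d, c] i) :=
    fun i => Subtype.ext (hpow i)
  have hη : ∀ i, IsPrimitiveRoot (![ζ₁ ^ l₂, ζ₁ ^ l₁, ζ₂ ^ l₄, ζ₂ ^ l₃] i)
      (![l₁, l₂, l₃, l₄] i) := by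
    intro i
    fin_cases i
    · exact hζ₁.pow (Nat.pos_of_ne_zero hn0) (hn.trans (mul_comm _ _))
    · exact hζ₁.pow (Nat.pos_of_ne_zero hn0) hn
    · exact hζ₂.pow (Nat.pos_of_ne_zero hm0) (hm.trans (mul_comm _ _))
    · exact hζ₂.pow (Nat.pos_of_ne_zero hm0) hm
  have hd0 : ∀ i, ![l₁, l₂, l₃, l₄] i ≠ 0 := by
    intro i
    fin_cases i <;> assumption
  have hgen : Algebra.adjoin F (Set.range w') = ⊤ := by
    have h1 : Set.range w' = Subtype.val ⁻¹' (Set.range w) := by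
      ext z
      simp [w', Subtype.ext_iff]
    rw [h1]
    exact Algebra.adjoin_adjoin_coe_preimage
  have hdim : ∏ i, ![l₁, l₂, l₃, l₄] i ≤ Module.finrank F L := by
    have hli := h.linearIndependent_subfield hn hm hn0 hm0
    have hli' : LinearIndependent F (fun I : (Fin l₁ × Fin l₂) × (Fin l₃ × Fin l₄) =>
        (w' 0 ^ (I.1.1 : ℕ) * w' 1 ^ (I.1.2 : ℕ)) *
          (w' 2 ^ (I.2.1 : ℕ) * w' 3 ^ (I.2.2 : ℕ))) :=
      LinearIndependent.of_comp L.val.toLinearMap hli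
    have := hli'.fintype_card_le_finrank
    simpa [Fin.prod_univ_four, mul_assoc] using this
  have hmax : ∀ z : A, (∀ i, Commute (w i) z) → z ∈ L := fun z hz =>
    h.mem_adjoin_of_commute hn hm hn0 hm0 hζ₁ hζ₂ hx₁ hy₁ hx₂ hy₂ (hz 1) (hz 0) (hz 3) (hz 2)
  obtain ⟨e₁⟩ := nonempty_mulEquiv_of_radicals hd0 hη hw0' hpow' hgen hdim
  obtain ⟨e₂⟩ := nonempty_mulEquiv_zmod_prod ![l₁, l₂, l₃, l₄]
  refine ⟨L, inferInstance, inferInstance, L.val, hLfin,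
    isGalois_of_radicals hd0 hη hw0' hpow' hgen, ⟨e₁.trans e₂⟩, ?_⟩
  rw [Subalgebra.range_val]
  -- A larger subfield is commutative, so its elements centralize the generators of `L` and already
  -- lie in `L`.
  refine ⟨Field.toIsField L, fun T hT hle z hz => hmax z fun i => ?_⟩
  exact congrArg Subtype.val
    (hT.mul_comm (⟨w i, hle (Algebra.subset_adjoin ⟨i, rfl⟩)⟩ : T) ⟨z, hz⟩)

end IsBisymbolBasis

/-! ### The rational function field -/

section

open Polynomial

attribute [local instance] Polynomial.algebra

/-- Localization in two stages: inverting the nonzero constants of `R` gives `K[X]`, and inverting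
its nonzero elements gives `K(X)`. -/
theorem RatFunc.isFractionRing_polynomial (R : Type*) (K : Type*) [CommRing R] [IsDomain R]
    [Field K] [Algebra R K] [IsFractionRing R K] : IsFractionRing R[X] (RatFunc K) := by
  have h := Polynomial.isLocalization (nonZeroDivisors R) K
  have hinj : Function.Injective (algebraMap R[X] K[X]) :=
    Polynomial.map_injective _ (IsFractionRing.injective R K)
  have h2 := IsLocalization.localization_localization_isLocalization_of_has_all_units
    ((nonZeroDivisors R).map (Polynomial.C : R →+* R[X])) (nonZeroDivisors K[X]) (RatFunc K)
    (fun x hx => hx.mem_nonZeroDivisors)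
  have h3 : (nonZeroDivisors K[X]).comap (algebraMap R[X] K[X]) = nonZeroDivisors R[X] := by
    ext p
    rw [Submonoid.mem_comap, mem_nonZeroDivisors_iff_ne_zero, mem_nonZeroDivisors_iff_ne_zero,
      map_ne_zero_iff _ hinj]
  rwa [h3] at h2

/-- Roots of unity are integral and `R` is integrally closed; this lets the symbols be defined over
`R[t]`. -/
theorem exists_lift_of_isPrimitiveRoot {R K : Type*} [CommRing R] [IsDomain R]
    [IsIntegrallyClosed R] [Field K] [Algebra R K] [IsFractionRing R K] {n : ℕ} (hn : n ≠ 0) {ζ : K}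
    (hζ : IsPrimitiveRoot ζ n) :
    ∃ z : R, algebraMap R K z = ζ ∧ IsPrimitiveRoot z n := by
  obtain ⟨z, rfl⟩ := IsIntegrallyClosed.isIntegral_iff.mp
    ((hζ.isIntegral (Nat.pos_of_ne_zero hn)).tower_top (A := R))
  exact ⟨z, rfl, hζ.of_map_of_injective (IsFractionRing.injective R K)⟩

/-- The minimal polynomial of the root divides `X ^ n - c` and has the same degree `n`, so the two
agree. -/
theorem irreducible_of_radicalDegreeEq {k : Type u} [Field k] {n : ℕ} (hn : n ≠ 0) {c : k}
    (h : RadicalDegreeEq k n c) : Irreducible (X ^ n - C c) := by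
  obtain ⟨α, hα, hdeg⟩ := h
  have hint : IsIntegral k α := Algebra.IsIntegral.isIntegral α
  rw [IntermediateField.adjoin.finrank hint] at hdeg
  have h1 : minpoly k α = X ^ n - C c := by
    refine (eq_of_monic_of_dvd_of_natDegree_le (minpoly.monic hint) (monic_X_pow_sub_C c hn)
      (minpoly.dvd k α (by simp [hα])) ?_).symm
    rw [natDegree_X_pow_sub_C, hdeg]
  rw [← h1]
  exact minpoly.irreducible hint

theorem noZeroDivisors_symbolTensor {R : Type u} [CommRing R] [IsDomain R]
    [IsDiscreteValuationRing R] {K : Type v} [Field K] [Algebra R K] [IsFractionRing R K]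
    {n m : ℕ} (hn : (n : IsLocalRing.ResidueField R) ≠ 0)
    (hm : (m : IsLocalRing.ResidueField R) ≠ 0) {ζ₁ ζ₂ : K} (hζ₁ : IsPrimitiveRoot ζ₁ n)
    (hζ₂ : IsPrimitiveRoot ζ₂ m) {π μ : R} (hπ : Irreducible π)
    (hμ : RadicalDegreeEq (IsLocalRing.ResidueField R) n (IsLocalRing.residue R μ)) :
    NoZeroDivisors (SymbolTensor K n m ζ₁ ζ₂ (algebraMap R K π) (algebraMap R K μ)) := by
  have hn0 : n ≠ 0 := by rintro rfl; simp at hn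
  have hm0 : m ≠ 0 := by rintro rfl; simp at hm
  obtain ⟨z₁, rfl, hz₁⟩ := exists_lift_of_isPrimitiveRoot (R := R) hn0 hζ₁
  obtain ⟨z₂, rfl, hz₂⟩ := exists_lift_of_isPrimitiveRoot (R := R) hm0 hζ₂
  have hker : ∀ r, IsLocalRing.residue R r = 0 ↔ π ∣ r := by
    intro r
    rw [IsLocalRing.residue_eq_zero_iff, hπ.maximalIdeal_eq, Ideal.mem_span_singleton]
  have := noZeroDivisors_symbolRing_tensor (IsLocalRing.residue R) hπ.ne_zero hker hn0 hm
    hz₁.pow_eq_one (neg_one_pow_mul_pow_of_isPrimitiveRoot hn0 hz₁) hz₂.pow_eq_one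
    (irreducible_of_radicalDegreeEq hn0 hμ)
  have := RatFunc.isFractionRing_polynomial R K
  have hC : ∀ r : R, algebraMap R[X] (RatFunc K) (C r) = RatFunc.C (algebraMap R K r) := by
    intro r
    rw [IsScalarTower.algebraMap_apply R[X] K[X] (RatFunc K), ← RatFunc.algebraMap_C]
    congr 1
    exact map_C _
  have hX : algebraMap R[X] (RatFunc K) X = RatFunc.X := by
    rw [IsScalarTower.algebraMap_apply R[X] K[X] (RatFunc K), ← RatFunc.algebraMap_X]
    congr 1
    exact map_X _
  refine noZeroDivisors_symbolAlgebra_tensor hn0 hm0 (S := R[X]) (ζ₁ := C z₁) (ζ₂ := C z₂)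
    (a := X) (b := C π - C μ * X) (c := X + 1) (d := C π) ?_ ?_ (hC _) (hC _) hX ?_ ?_ (hC _)
  · rw [← map_pow, hz₁.pow_eq_one, map_one]
  · rw [← map_pow, hz₂.pow_eq_one, map_one]
  · rw [map_sub, map_mul, hC, hC, hX]
  · rw [map_add, map_one, hX]

end

/-! ### Nonzero symbol entries and assembly of the theorem -/

theorem RatFunc.X_add_one_ne_zero {K : Type*} [Field K] : (RatFunc.X + 1 : RatFunc K) ≠ 0 := by
  rw [← RatFunc.algebraMap_X, ← map_one (algebraMap (Polynomial K) (RatFunc K)), ← map_add]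
  exact (map_ne_zero_iff _ (RatFunc.algebraMap_injective K)).mpr (Polynomial.X_add_C_ne_zero 1)

theorem RatFunc.C_sub_C_mul_X_ne_zero {K : Type*} [Field K] {p q : K} (hp : p ≠ 0) :
    (RatFunc.C p - RatFunc.C q * RatFunc.X : RatFunc K) ≠ 0 := by
  rw [← RatFunc.algebraMap_X, ← RatFunc.algebraMap_C, ← RatFunc.algebraMap_C, ← map_mul, ← map_sub]
  refine (map_ne_zero_iff _ (RatFunc.algebraMap_injective K)).mpr fun h => hp ?_
  simpa using congrArg (Polynomial.eval 0) h

theorem isCentralDivisionAlgebra_symbolTensor {R : Type u} [CommRing R] [IsDomain R]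
    [IsDiscreteValuationRing R] {K : Type v} [Field K] [Algebra R K] [IsFractionRing R K]
    {n m : ℕ} (hn : (n : IsLocalRing.ResidueField R) ≠ 0)
    (hm : (m : IsLocalRing.ResidueField R) ≠ 0) {ζ₁ ζ₂ : K} (hζ₁ : IsPrimitiveRoot ζ₁ n)
    (hζ₂ : IsPrimitiveRoot ζ₂ m) {π μ : R} (hπ : Irreducible π)
    (hμ : RadicalDegreeEq (IsLocalRing.ResidueField R) n (IsLocalRing.residue R μ)) :
    IsCentralDivisionAlgebra (RatFunc K)
      (SymbolTensor K n m ζ₁ ζ₂ (algebraMap R K π) (algebraMap R K μ)) ∧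
    ∀ l₁ l₂ l₃ l₄ : ℕ, n = l₁ * l₂ → m = l₃ * l₄ →
      HasMaximalGaloisSubfield (RatFunc K)
        (SymbolTensor K n m ζ₁ ζ₂ (algebraMap R K π) (algebraMap R K μ))
        (Multiplicative (ZMod l₁ × ZMod l₂ × ZMod l₃ × ZMod l₄)) := by
  have hn0 : n ≠ 0 := by rintro rfl; simp at hn
  have hm0 : m ≠ 0 := by rintro rfl; simp at hm
  have := noZeroDivisors_symbolTensor hn hm hζ₁ hζ₂ hπ hμ
  have hCinj : Function.Injective (RatFunc.C : K →+* RatFunc K) := RingHom.injective _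
  have hζ₁' : IsPrimitiveRoot (RatFunc.C ζ₁) n := hζ₁.map_of_injective hCinj
  have hζ₂' : IsPrimitiveRoot (RatFunc.C ζ₂) m := hζ₂.map_of_injective hCinj
  have hπK : algebraMap R K π ≠ 0 :=
    (map_ne_zero_iff _ (IsFractionRing.injective R K)).mpr hπ.ne_zero
  have hπF : RatFunc.C (algebraMap R K π) ≠ 0 := (map_ne_zero_iff _ hCinj).mpr hπK
  obtain ⟨x₁, y₁, x₂, y₂, E, h⟩ := exists_isBisymbolBasis hn0 hm0 hζ₁'.pow_eq_one hζ₂'.pow_eq_one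
    RatFunc.X (RatFunc.C (algebraMap R K π) - RatFunc.C (algebraMap R K μ) * RatFunc.X)
    (RatFunc.X + 1) (RatFunc.C (algebraMap R K π))
  exact ⟨h.isCentralDivisionAlgebra hn0 hm0 hζ₁' hζ₂' RatFunc.X_ne_zero
      (RatFunc.C_sub_C_mul_X_ne_zero hπK) RatFunc.X_add_one_ne_zero hπF,
    fun l₁ l₂ l₃ l₄ hnl hml => h.hasMaximalGaloisSubfield hnl hml hn0 hm0 hζ₁' hζ₂'
      RatFunc.X_ne_zero (RatFunc.C_sub_C_mul_X_ne_zero hπK) RatFunc.X_add_one_ne_zero hπF⟩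

theorem theorem4p5 {R : Type u} [CommRing R] [IsDomain R] [IsDiscreteValuationRing R]
    {K : Type v} [Field K] [Algebra R K] [IsFractionRing R K] :
    (∀ n m : ℕ, (n : IsLocalRing.ResidueField R) ≠ 0 → (m : IsLocalRing.ResidueField R) ≠ 0 →
      ∀ ζ₁ ζ₂ : K, IsPrimitiveRoot ζ₁ n → IsPrimitiveRoot ζ₂ m →
      ∀ l₀ : IsLocalRing.ResidueField R,
        RadicalDegreeEq (IsLocalRing.ResidueField R) n l₀ →
      ∀ π μ : R, Irreducible π → IsLocalRing.residue R μ = l₀ →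
        IsCentralDivisionAlgebra (RatFunc K)
          (SymbolTensor K n m ζ₁ ζ₂ (algebraMap R K π) (algebraMap R K μ))) ∧
    (∀ l₁ l₂ l₃ l₄ : ℕ, ((l₁ * l₂ * l₃ * l₄ : ℕ) : IsLocalRing.ResidueField R) ≠ 0 →
      (∃ ζ : K, IsPrimitiveRoot ζ (l₁ * l₂ * l₃ * l₄)) →
      ∀ l₀ : IsLocalRing.ResidueField R,
        RadicalDegreeEq (IsLocalRing.ResidueField R) (l₁ * l₂) l₀ →
      IsAdmissible (RatFunc K) (Multiplicative (ZMod l₁ × ZMod l₂ × ZMod l₃ × ZMod l₄)) ∧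
      ∀ ζ₁ ζ₂ : K, IsPrimitiveRoot ζ₁ (l₁ * l₂) → IsPrimitiveRoot ζ₂ (l₃ * l₄) →
      ∀ π μ : R, Irreducible π → IsLocalRing.residue R μ = l₀ →
        IsCentralDivisionAlgebra (RatFunc K)
          (SymbolTensor K (l₁ * l₂) (l₃ * l₄) ζ₁ ζ₂ (algebraMap R K π) (algebraMap R K μ)) ∧
        HasMaximalGaloisSubfield (RatFunc K)
          (SymbolTensor K (l₁ * l₂) (l₃ * l₄) ζ₁ ζ₂ (algebraMap R K π) (algebraMap R K μ))
          (Multiplicative (ZMod l₁ × ZMod l₂ × ZMod l₃ × ZMod l₄))) := by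
  refine ⟨fun n m hn hm ζ₁ ζ₂ hζ₁ hζ₂ l₀ hl₀ π μ hπ hμ =>
    (isCentralDivisionAlgebra_symbolTensor hn hm hζ₁ hζ₂ hπ (hμ ▸ hl₀)).1, ?_⟩
  rintro l₁ l₂ l₃ l₄ hl ⟨ζ, hζ⟩ l₀ hl₀
  have hn : ((l₁ * l₂ : ℕ) : IsLocalRing.ResidueField R) ≠ 0 := by
    intro h
    rw [mul_assoc, Nat.cast_mul, h, zero_mul] at hl
    exact hl rfl
  have hm : ((l₃ * l₄ : ℕ) : IsLocalRing.ResidueField R) ≠ 0 := by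
    intro h
    rw [mul_assoc, Nat.cast_mul, h, mul_zero] at hl
    exact hl rfl
  have key : ∀ ζ₁ ζ₂ : K, IsPrimitiveRoot ζ₁ (l₁ * l₂) → IsPrimitiveRoot ζ₂ (l₃ * l₄) →
      ∀ π μ : R, Irreducible π → IsLocalRing.residue R μ = l₀ →
        IsCentralDivisionAlgebra (RatFunc K)
          (SymbolTensor K (l₁ * l₂) (l₃ * l₄) ζ₁ ζ₂ (algebraMap R K π) (algebraMap R K μ)) ∧
        HasMaximalGaloisSubfield (RatFunc K)
          (SymbolTensor K (l₁ * l₂) (l₃ * l₄) ζ₁ ζ₂ (algebraMap R K π) (algebraMap R K μ))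
          (Multiplicative (ZMod l₁ × ZMod l₂ × ZMod l₃ × ZMod l₄)) := by
    intro ζ₁ ζ₂ hζ₁ hζ₂ π μ hπ hμ
    obtain ⟨h1, h2⟩ := isCentralDivisionAlgebra_symbolTensor hn hm hζ₁ hζ₂ hπ (hμ ▸ hl₀)
    exact ⟨h1, h2 l₁ l₂ l₃ l₄ rfl rfl⟩
  refine ⟨?_, key⟩
  have hpos : 0 < l₁ * l₂ * l₃ * l₄ := by
    refine Nat.pos_of_ne_zero fun h => hl ?_
    rw [h, Nat.cast_zero]
  obtain ⟨π, hπ⟩ := IsDiscreteValuationRing.exists_irreducible R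
  obtain ⟨μ, hμ⟩ := IsLocalRing.residue_surjective l₀
  -- Raising `ζ` to the complementary factor of its order gives primitive roots of orders `l₁ * l₂`
  -- and `l₃ * l₄`.
  exact ⟨_, inferInstance, inferInstance, key (ζ ^ (l₃ * l₄)) (ζ ^ (l₁ * l₂))
    (hζ.pow hpos (by ring)) (hζ.pow hpos (by ring)) π μ hπ hμ⟩
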